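/- Let $n$ be a natural number and $\hbar>0$. Write $z=(x,p)\in\mathbb{R}^{n}\times\mathbb{R}^{n}=\mathbb{R}^{2n}$, and for $\psi\in L^{2}(\mathbb{R}^{n})$ let $$W\psi(x,p)=\left(\tfrac{1}{2\pi\hbar}\right)^{n}\int_{\mathbb{R}^{n}}e^{-\frac{i}{\hbar}p\cdot y}\,\psi(x+\tfrac12 y)\,\overline{\psi(x-\tfrac12 y)}\,dy$$ be its Wigner transform, which is real-valued. Let $\psi_{0}(x)=(\pi\hbar)^{-n/4}e^{-\frac{1}{2\hbar}|x|^{2}}$. Let $\operatorname{Mp}(n,\mathbb{R})$ be the metaplectic group, i.e. the group of unitary operators on $L^{2}(\mathbb{R}^{n})$ generated by the operators $\psi(x)\mapsto e^{\frac{i}{2\hbar}Px\cdot x}\psi(x)$ ($P=P^{T}$ a real $n\times n$ matrix), $\psi(x)\mapsto i^{m}\sqrt{|\det L|}\,\psi(Lx)$ ($\det L\neq 0$, $m\in\mathbb{Z}$, $m\pi\equiv\arg\det L$ mod $2\pi$) and $\psi(x)\mapsto(2\pi i\hbar)^{-n/2}\int e^{-\frac{i}{\hbar}x\cdot y}\psi(y)\,dy$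 (with $\arg i=\pi/2$). Its covering projection onto $\operatorname{Sp}(n,\mathbb{R})$ is the homomorphism sending these generators to $$\begin{pmatrix}I&0\\P&I\end{pmatrix},\qquad\begin{pmatrix}L^{-1}&0\\0&L^{T}\end{pmatrix},\qquad\begin{pmatrix}0&I\\-I&0\end{pmatrix}$$ respectively; $\widehat S\in\operatorname{Mp}(n,\mathbb{R})$ covers $S$ if its projection is $S$. **Corollary.** Let $M$ be a positive-definite real symmetric $2n\times 2n$ matrix whose ellipsoid $\mathcal{B}_{M}=\{z: Mz\cdot z\le\hbar\}$ is a "quantum blob": $\mathcal{B}_{M}=S(B(\sqrt{\hbar}))$ for some $S\in\operatorname{Sp}(n,\mathbb{R})$, where $B(\sqrt\hbar)=\{z:|z|\le\sqrt\hbar\}$. Let $\psi\in L^{2}(\mathbb{R}^{n})$ and suppose that for some $C\in\mathbb{R}$ $$W\psi(z)\le C\,e^{-\frac{1}{\hbar}Mz\cdot z}\qquad\text{for all }z\in\mathbb{R}^{2n}.$$ Then $\psi$ is proportional to the squeezed coherent state $\widehat S\psi_{0}$, where $\widehat S$ is any metaplectic operator covering $S$. That is: there is a metaplectic operator covering $S$,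 and for every metaplectic operator $\widehat S$ covering $S$ there is $c\in\mathbb{C}$ with $\psi=c\,\widehat S\psi_{0}$. -/

import Mathlib

open MeasureTheory

noncomputable section

namespace QuantumBlob

/-- Configuration space `ℝⁿ` with its Euclidean structure. -/
abbrev Config (n : ℕ) : Type := EuclideanSpace ℝ (Fin n)

/-- Phase space `ℝ²ⁿ`, with points `z = (x, p)`: the `Sum.inl` coordinates are `x`, the `Sum.inr`
coordinates are `p`. -/
abbrev Phase (n : ℕ) : Type := EuclideanSpace ℝ (Fin n ⊕ Fin n)

/-- The Hilbert space `L²(ℝⁿ)` of complex valued functions (with Lebesgue measure). -/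
abbrev L2 (n : ℕ) : Type := Lp ℂ 2 (volume : Measure (Config n))

variable {n : ℕ}

/-- The position part `x` of `z = (x, p)`. -/
def position (z : Phase n) : Config n := WithLp.toLp 2 fun i => z (Sum.inl i)

/-- The momentum part `p` of `z = (x, p)`. -/
def momentum (z : Phase n) : Config n := WithLp.toLp 2 fun i => z (Sum.inr i)

/-- The Wigner–Moyal transform
`W(ψ, φ)(x, p) = (2πħ)⁻ⁿ ∫ exp (-(i/ħ) p · y) ψ(x + y/2) conj (φ(x - y/2)) dy`. -/
def wignerMoyal (ħ : ℝ) (ψ φ : L2 n) (z : Phase n) : ℂ :=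
  (1 / (2 * Real.pi * ħ : ℂ)) ^ n *
    ∫ y : Config n, Complex.exp (-(Complex.I / ħ) * (inner ℝ (momentum z) y : ℝ)) *
      ψ (position z + (1 / 2 : ℝ) • y) *
      (starRingEnd ℂ) (φ (position z - (1 / 2 : ℝ) • y))

/-- The Wigner transform `Wψ = W(ψ, ψ)`, a real valued function on phase space
(see `wignerMoyal_self`). -/
def wigner (ħ : ℝ) (ψ : L2 n) (z : Phase n) : ℝ := (wignerMoyal ħ ψ ψ z).re

/-- `W(ψ, ψ)` is real valued, so that taking the real part in `wigner` loses nothing. -/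
theorem wignerMoyal_self (ħ : ℝ) (ψ : L2 n) (z : Phase n) :
    wignerMoyal ħ ψ ψ z = (wigner ħ ψ z : ℂ) := by
  refine (Complex.conj_eq_iff_re.mp ?_).symm
  unfold wignerMoyal
  rw [map_mul, ← integral_conj, ← integral_neg_eq_self]
  congr 1
  · simp [map_ofNat]
  · refine integral_congr_ae (Filter.Eventually.of_forall fun y => ?_)
    simp only [map_mul, ← Complex.exp_conj, inner_neg_right, smul_neg, sub_neg_eq_add,
      Complex.conj_conj, map_neg, map_div₀, Complex.conj_I, Complex.conj_ofReal,
      ← sub_eq_add_neg, Complex.ofReal_neg]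
    ring_nf

/-- The linear map `z ↦ M z` of phase space. -/
def act (M : Matrix (Fin n ⊕ Fin n) (Fin n ⊕ Fin n) ℝ) (z : Phase n) : Phase n :=
  Matrix.toEuclideanLin M z

/-- The phase space ellipsoid `B_M : Mz · z ≤ ħ`. -/
def ellipsoid (ħ : ℝ) (M : Matrix (Fin n ⊕ Fin n) (Fin n ⊕ Fin n) ℝ) : Set (Phase n) :=
  {z | inner ℝ (act M z) z ≤ ħ}

/-- The function `ψ₀(x) = (πħ)^(-n/4) exp (-|x|² / (2ħ))`. -/
def gaussianFun (n : ℕ) (ħ : ℝ) (x : Config n) : ℂ :=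
  (((Real.pi * ħ) ^ (-(n : ℝ) / 4) * Real.exp (-(1 / (2 * ħ)) * ‖x‖ ^ 2) : ℝ) : ℂ)

theorem memLp_gaussianFun (n : ℕ) {ħ : ℝ} (hħ : 0 < ħ) :
    MemLp (gaussianFun n ħ) 2 (volume : Measure (Config n)) := by
  have hc : Continuous (gaussianFun n ħ) := by unfold gaussianFun; fun_prop
  rw [memLp_two_iff_integrable_sq_norm hc.aestronglyMeasurable]
  have h := (GaussianFourier.integrable_cexp_neg_mul_sq_norm_add (V := Config n)
    (b := ((1 / ħ : ℝ) : ℂ)) (by rw [Complex.ofReal_re]; positivity) 0 0).norm.const_mul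
    (((Real.pi * ħ) ^ (-(n : ℝ) / 4)) ^ 2)
  refine h.congr (Filter.Eventually.of_forall fun x => ?_)
  simp only [gaussianFun, Complex.norm_real, Complex.norm_exp, Real.norm_eq_abs, sq_abs, mul_pow]
  rw [← Real.exp_nat_mul]
  congr 2
  have : (-((1 / ħ : ℝ) : ℂ) * (‖x‖ : ℂ) ^ 2 + 0 * ((inner ℝ (0 : Config n) x : ℝ) : ℂ))
      = ((-(1 / ħ) * ‖x‖ ^ 2 : ℝ) : ℂ) := by push_cast; ring
  rw [this, Complex.ofReal_re]
  push_cast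
  field_simp

/-- The standard coherent state `ψ₀`, as an element of `L²(ℝⁿ)`. -/
def coherentState (n : ℕ) {ħ : ℝ} (hħ : 0 < ħ) : L2 n := (memLp_gaussianFun n hħ).toLp

/-- `U` is the chirp multiplication `ψ(x) ↦ exp ((i/2ħ) Px · x) ψ(x)`. -/
def IsChirp (ħ : ℝ) (P : Matrix (Fin n) (Fin n) ℝ) (U : L2 n ≃ₗᵢ[ℂ] L2 n) : Prop :=
  ∀ ψ : L2 n, U ψ =ᵐ[volume] fun x =>
    Complex.exp (Complex.I / (2 * ħ) * (inner ℝ (Matrix.toEuclideanLin P x) x : ℝ)) * ψ x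

/-- `U` is the operator `ψ(x) ↦ i^m √|det L| ψ(Lx)`. -/
def IsDilation (L : Matrix (Fin n) (Fin n) ℝ) (m : ℤ) (U : L2 n ≃ₗᵢ[ℂ] L2 n) : Prop :=
  ∀ ψ : L2 n, U ψ =ᵐ[volume] fun x =>
    Complex.I ^ m * (Real.sqrt |L.det| : ℝ) * ψ (Matrix.toEuclideanLin L x)

/-- `U` is the normalized Fourier transform
`ψ(x) ↦ (2πiħ)^(-n/2) ∫ exp (-(i/ħ) x · y) ψ(y) dy`, the power being taken with `arg i = π/2`
(the integral formula on `L¹ ∩ L²` determines the unitary operator `U`). -/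
def IsFourier (ħ : ℝ) (U : L2 n ≃ₗᵢ[ℂ] L2 n) : Prop :=
  ∀ ψ : L2 n, Integrable ψ volume → U ψ =ᵐ[volume] fun x =>
    (2 * Real.pi * Complex.I * ħ : ℂ) ^ (-(n : ℂ) / 2) *
      ∫ y : Config n, Complex.exp (-(Complex.I / ħ) * (inner ℝ x y : ℝ)) * ψ y

/-- The generators of the metaplectic group, each together with its projection to `Sp(n, ℝ)`. In the
second case the integer `m` satisfies `mπ ≡ arg (det L)` modulo `2π`. -/
inductive IsGenerator (ħ : ℝ) :
    (L2 n ≃ₗᵢ[ℂ] L2 n) → Matrix (Fin n ⊕ Fin n) (Fin n ⊕ Fin n) ℝ → Prop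
  | chirp (P : Matrix (Fin n) (Fin n) ℝ) (hP : P.IsSymm) (U : L2 n ≃ₗᵢ[ℂ] L2 n)
      (hU : IsChirp ħ P U) : IsGenerator ħ U (Matrix.fromBlocks 1 0 P 1)
  | dilation (L : Matrix (Fin n) (Fin n) ℝ) (m : ℤ)
      (hm : (Even m ∧ 0 < L.det) ∨ (Odd m ∧ L.det < 0)) (U : L2 n ≃ₗᵢ[ℂ] L2 n)
      (hU : IsDilation L m U) : IsGenerator ħ U (Matrix.fromBlocks L⁻¹ 0 0 L.transpose)
  | fourier (U : L2 n ≃ₗᵢ[ℂ] L2 n) (hU : IsFourier ħ U) :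
      IsGenerator ħ U (Matrix.fromBlocks 0 1 (-1) 0)

/-- The graph of the covering projection `Mp(n, ℝ) → Sp(n, ℝ)`: the group of pairs
(metaplectic operator, its projection) generated by the generators of `Mp(n, ℝ)` paired with their
projections. -/
def metaplecticGraph (n : ℕ) (ħ : ℝ) :
    Subgroup ((L2 n ≃ₗᵢ[ℂ] L2 n) × Matrix.symplecticGroup (Fin n) ℝ) :=
  Subgroup.closure {g | IsGenerator ħ g.1 (g.2 : Matrix (Fin n ⊕ Fin n) (Fin n ⊕ Fin n) ℝ)}

/-- The metaplectic group `Mp(n, ℝ)`, a group of unitary operators on `L²(ℝⁿ)`. -/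
def metaplecticGroup (n : ℕ) (ħ : ℝ) : Subgroup (L2 n ≃ₗᵢ[ℂ] L2 n) :=
  (metaplecticGraph n ħ).map (MonoidHom.fst _ _)

/-- The metaplectic operator `U` covers the symplectic matrix `S`, i.e. `S` is its projection. -/
def Covers (ħ : ℝ) (U : metaplecticGroup n ħ) (S : Matrix.symplecticGroup (Fin n) ℝ) : Prop :=
  ((U : L2 n ≃ₗᵢ[ℂ] L2 n), S) ∈ metaplecticGraph n ħ

end QuantumBlob

end

/-! Metaplectic covariance reduces the problem to the standard Gaussian, and Liouville's theorem for
the Bargmann transform settles that case.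

Covariance: up to a constant, `Wψ(z)` is the inner product of `ψ` with its Grossmann–Royer
reflection at `z` (`wignerMoyal_eq_inner_reflection`). Metaplectic operators carry the reflection at
`z` to the reflection at `Sz`; this is checked on the generators and passes to the group
(`intertwines_of_mem_metaplecticGraph`), so `W(Ŝψ)(Sz) = Wψ(z)`. The blob condition says `MSz · Sz =
|z|²` (`inner_act_eq_norm_sq`), hence `φ = Ŝ⁻¹ψ` satisfies `Wφ(z) ≤ C exp(-|z|²/ħ)`.

Standard case: averaging `Wφ` against a positive Gaussian centred at `(x, q)` gives the squared
overlap of `φ` with a Gaussian packet (`husimi_identity`). The one-sided bound therefore controls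
`|overlap|²` by `K exp(-(|x|² + |q|²)/2ħ)`. Along a complex line the overlap is an explicit factor
times an entire function, and this decay is exactly what makes that function bounded after
multiplication by `exp(-ħ|q|²t²/4)`. By Liouville it is a constant times a Gaussian
(`bargmannLine_eq_of_wigner_le`), as for `ψ₀`. Evaluation at `t = -i` is a Fourier transform, whose
injectivity gives `φ = cψ₀`.

Existence of `Ŝ` is separate: the generators exist as unitary operators, and their projections
generate the symplectic group (`exists_covers`). -/

noncomputable section

namespace QuantumBlob

/-! ### Unitary weighted composition operators on `L²` -/

section WeightedComposition

variable {α : Type*} [MeasurableSpace α] {μ : Measure α}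

theorem eLpNorm_weighted_comp (e : α ≃ᵐ α) {m : α → ℂ} {r : ℝ} (hr : 0 < r)
    (hmr : ∀ x, ‖m x‖ = r) (he : Measure.map e μ = ENNReal.ofReal ((r ^ 2)⁻¹) • μ) {f : α → ℂ}
    (hf : AEStronglyMeasurable f μ) :
    eLpNorm (fun x => m x * f (e x)) 2 μ = eLpNorm f 2 μ := by
  have h1 : eLpNorm (fun x => m x * f (e x)) 2 μ = eLpNorm ((r : ℂ) • (f ∘ e)) 2 μ := by
    refine eLpNorm_congr_norm_ae (Filter.Eventually.of_forall fun x => ?_)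
    simp [hmr, abs_of_pos hr]
  have h2 : AEStronglyMeasurable f (Measure.map e μ) := by
    rw [he]; exact hf.smul_measure _
  have hpos : 0 < (r ^ 2)⁻¹ := by positivity
  rw [h1, eLpNorm_const_smul, ← eLpNorm_map_measure h2 e.measurable.aemeasurable, he,
    eLpNorm_smul_measure_of_ne_zero (by simpa using hr.ne'), smul_eq_mul, ← mul_assoc]
  have : ‖(r : ℂ)‖ₑ * ENNReal.ofReal (r ^ 2)⁻¹ ^ ((1 : ENNReal) / 2).toReal = 1 := by
    rw [ENNReal.ofReal_rpow_of_pos hpos, ← ofReal_norm, ← ENNReal.ofReal_mul (by positivity)]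
    simp only [Complex.norm_real, Real.norm_eq_abs, abs_of_pos hr, one_div, ENNReal.toReal_inv,
      ENNReal.toReal_ofNat]
    rw [← one_div (2 : ℝ), ← Real.sqrt_eq_rpow, Real.sqrt_inv, Real.sqrt_sq hr.le,
      mul_inv_cancel₀ hr.ne', ENNReal.ofReal_one]
  rw [this, one_mul]

/-- A weighted composition operator whose weight has constant modulus balancing the scaling of the
measure is unitary on `L²`. -/
theorem exists_weighted_comp (e : α ≃ᵐ α) {m : α → ℂ} (hm : Measurable m) {r : ℝ} (hr : 0 < r)
    (hmr : ∀ x, ‖m x‖ = r) (he : Measure.map e μ = ENNReal.ofReal ((r ^ 2)⁻¹) • μ) :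
    ∃ U : Lp ℂ 2 μ ≃ₗᵢ[ℂ] Lp ℂ 2 μ, ∀ ψ, U ψ =ᵐ[μ] fun x => m x * ψ (e x) := by
  have hq : Measure.QuasiMeasurePreserving e μ μ :=
    ⟨e.measurable, by rw [he]; exact Measure.smul_absolutelyContinuous⟩
  have hpos : 0 < (r ^ 2)⁻¹ := by positivity
  have hq' : Measure.QuasiMeasurePreserving e.symm μ μ := by
    refine ⟨e.symm.measurable, ?_⟩
    have h2 : Measure.map e.symm (Measure.map e μ) = μ := by simp
    rw [he, Measure.map_smul] at h2
    intro s hs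
    rw [← h2] at hs
    simpa [hr.ne', not_le, hpos] using hs
  have hmem : ∀ f : Lp ℂ 2 μ, MemLp (fun x => m x * f (e x)) 2 μ := fun f => by
    refine ⟨hm.aestronglyMeasurable.mul
      ((Lp.aestronglyMeasurable f).comp_quasiMeasurePreserving hq), ?_⟩
    rw [eLpNorm_weighted_comp e hr hmr he (Lp.aestronglyMeasurable f)]
    exact Lp.eLpNorm_lt_top f
  let T : Lp ℂ 2 μ →ₗᵢ[ℂ] Lp ℂ 2 μ :=
    { toFun := fun f => (hmem f).toLp
      map_add' := fun f g => by
        apply Lp.ext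
        filter_upwards [(hmem (f + g)).coeFn_toLp, (hmem f).coeFn_toLp, (hmem g).coeFn_toLp,
          Lp.coeFn_add (hmem f).toLp (hmem g).toLp, hq.ae (Lp.coeFn_add f g)] with x h1 h2 h3 h4 h5
        rw [h1, h4, Pi.add_apply, h2, h3, h5, Pi.add_apply, mul_add]
      map_smul' := fun c f => by
        apply Lp.ext
        filter_upwards [(hmem (c • f)).coeFn_toLp, (hmem f).coeFn_toLp,
          Lp.coeFn_smul c (hmem f).toLp, hq.ae (Lp.coeFn_smul c f)] with x h1 h2 h4 h5
        rw [h1, RingHom.id_apply, h4, Pi.smul_apply, h2, h5, Pi.smul_apply, smul_eq_mul,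
          smul_eq_mul, mul_left_comm]
      norm_map' := fun f => by
        change ‖(hmem f).toLp‖ = ‖f‖
        rw [Lp.norm_toLp, eLpNorm_weighted_comp e hr hmr he (Lp.aestronglyMeasurable f),
          Lp.norm_def] }
  have hT : ∀ f, T f =ᵐ[μ] fun x => m x * f (e x) := fun f => (hmem f).coeFn_toLp
  have hsurj : Function.Surjective T := fun g => by
    have hm0 : ∀ x, m x ≠ 0 := fun x h => hr.ne' (by rw [← hmr x, h, norm_zero])
    have hmeas : AEStronglyMeasurable (fun y => (m (e.symm y))⁻¹ * g (e.symm y)) μ :=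
      ((hm.comp e.symm.measurable).inv).aestronglyMeasurable.mul
        ((Lp.aestronglyMeasurable g).comp_quasiMeasurePreserving hq')
    have hL : MemLp (fun y => (m (e.symm y))⁻¹ * g (e.symm y)) 2 μ := by
      refine ⟨hmeas, ?_⟩
      -- The norm identity is used backwards: applying the operator to the candidate preimage
      -- returns `g`, whose norm is finite.
      rw [← eLpNorm_weighted_comp e hr hmr he hmeas]
      simpa [hm0] using Lp.eLpNorm_lt_top g
    refine ⟨hL.toLp, Lp.ext ?_⟩
    filter_upwards [hT hL.toLp, hq.ae hL.coeFn_toLp] with x h1 h2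
    rw [h1, h2, e.symm_apply_apply, mul_inv_cancel_left₀ (hm0 x)]
  exact ⟨LinearIsometryEquiv.ofSurjective T hsurj, hT⟩

end WeightedComposition

/-! ### The `L²` Fourier transform on `L¹ ∩ L²` -/

section Fourier

open scoped FourierTransform

variable {E : Type*} [NormedAddCommGroup E] [InnerProductSpace ℝ E] [FiniteDimensional ℝ E]
  [MeasurableSpace E] [BorelSpace E]

/-- On `L¹ ∩ L²` the Fourier transform of `L²` is given by the Fourier integral. -/
theorem fourierTransform_ae_eq (f : Lp (α := E) ℂ 2) (hf : Integrable f) :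
    Lp.fourierTransformₗᵢ E ℂ f =ᵐ[volume] 𝓕 (f : E → ℂ) := by
  -- Smooth compactly supported functions are Schwartz, so the distributional definition of the `L²`
  -- transform and the self-adjointness of the Fourier integral give equal pairings.
  refine ae_eq_of_integral_contDiff_smul_eq
    ((Lp.memLp _).locallyIntegrable (by norm_num)) ?_ fun g hg hgc => ?_
  · exact (VectorFourier.fourierIntegral_continuous Real.continuous_fourierChar
      (by exact continuous_inner) hf).locallyIntegrable
  · have hgs : HasCompactSupport fun x => (g x : ℂ) :=
      hgc.comp_left (g := fun t : ℝ => (t : ℂ)) Complex.ofReal_zero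
    have hgd : ContDiff ℝ ((⊤ : ℕ∞) : WithTop ℕ∞) fun x => (g x : ℂ) := Complex.ofRealCLM.contDiff.comp hg
    let G : SchwartzMap E ℂ := hgs.toSchwartzMap hgd
    have hG : ∀ x, G x = (g x : ℂ) := fun x => rfl
    have h1 := congrArg (fun T => T G) (Lp.fourier_toTemperedDistribution_eq f)
    simp only [TemperedDistribution.fourier_apply, Lp.toTemperedDistribution_apply] at h1
    have h2 := VectorFourier.integral_fourierIntegral_smul_eq_flip (μ := (volume : Measure E))
      (ν := (volume : Measure E)) (L := innerₗ E) (f := G) (g := f)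
      Real.continuous_fourierChar (by exact continuous_inner) G.integrable hf
    rw [flip_innerₗ] at h2
    have h3 : ∫ x, G x • (Lp.fourierTransformₗᵢ E ℂ f) x = ∫ x, G x • 𝓕 (f : E → ℂ) x := by
      exact h1.symm.trans h2
    simpa only [hG, Complex.real_smul, smul_eq_mul] using h3

theorem eq_zero_of_fourier_eq_zero (f : Lp (α := E) ℂ 2) (hf : Integrable f)
    (h : ∀ w, ∫ x, Complex.exp (-Complex.I * (inner ℝ w x : ℝ)) * f x = 0) : f = 0 := by
  rw [← map_eq_zero_iff (Lp.fourierTransformₗᵢ E ℂ) (Lp.fourierTransformₗᵢ E ℂ).injective]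
  refine (Lp.eq_zero_iff_ae_eq_zero).2 ((fourierTransform_ae_eq f hf).trans
    (Filter.Eventually.of_forall fun w => ?_))
  rw [Real.fourier_eq', Pi.zero_apply, ← h ((2 * Real.pi) • w)]
  refine integral_congr_ae (Filter.Eventually.of_forall fun x => ?_)
  simp only [inner_smul_left, smul_eq_mul, real_inner_comm w x]
  congr 2
  push_cast
  simp
  ring

end Fourier

variable {n : ℕ} {ħ : ℝ}

/-! ### Existence of the metaplectic generators -/

theorem map_measurableEquiv_of_linear (e : Config n ≃ᵐ Config n) (L : Config n →ₗ[ℝ] Config n)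
    (h : ∀ x, e x = L x) (hL : LinearMap.det L ≠ 0) :
    Measure.map e volume = ENNReal.ofReal |(LinearMap.det L)⁻¹| • (volume : Measure (Config n)) := by
  rw [← Measure.map_linearMap_addHaar_eq_smul_addHaar _ hL]
  congr 1
  exact funext h

theorem exists_isChirp (ħ : ℝ) (P : Matrix (Fin n) (Fin n) ℝ) :
    ∃ U : L2 n ≃ₗᵢ[ℂ] L2 n, IsChirp ħ P U := by
  refine exists_weighted_comp (MeasurableEquiv.refl _)
    (m := fun x => Complex.exp (Complex.I / (2 * ħ) *
      (inner ℝ (Matrix.toEuclideanLin P x) x : ℝ))) ?_ one_pos (fun x => ?_)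
    (by rw [one_pow, inv_one, ENNReal.ofReal_one, one_smul]; exact Measure.map_id)
  · have : Continuous fun x => Matrix.toEuclideanLin P x := LinearMap.continuous_of_finiteDimensional _
    fun_prop
  · rw [Complex.norm_exp]
    have : (Complex.I / (2 * ħ) * (inner ℝ (Matrix.toEuclideanLin P x) x : ℝ))
      = ((inner ℝ (Matrix.toEuclideanLin P x) x / (2 * ħ) : ℝ) : ℂ) * Complex.I := by
      push_cast; ring
    rw [this, Complex.re_ofReal_mul, Complex.I_re, mul_zero, Real.exp_zero]

theorem exists_weighted_linear (L : Config n →ₗ[ℝ] Config n) (hL : LinearMap.det L ≠ 0) (c : ℂ)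
    (hc : ‖c‖ = Real.sqrt |LinearMap.det L|) :
    ∃ U : L2 n ≃ₗᵢ[ℂ] L2 n, ∀ ψ, U ψ =ᵐ[volume] fun x => c * ψ (L x) := by
  let e : Config n ≃ᵐ Config n :=
    (LinearMap.equivOfDetNeZero L hL).toContinuousLinearEquiv.toHomeomorph.toMeasurableEquiv
  have he : ∀ x, e x = L x := fun x => rfl
  have h := exists_weighted_comp (μ := (volume : Measure (Config n))) e (m := fun _ => c)
    measurable_const
    (r := Real.sqrt |LinearMap.det L|) (Real.sqrt_pos.2 (abs_pos.2 hL)) (fun _ => hc) (by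
      rw [map_measurableEquiv_of_linear e L he hL, Real.sq_sqrt (abs_nonneg _), abs_inv])
  exact h

theorem exists_isDilation (L : Matrix (Fin n) (Fin n) ℝ) (m : ℤ) (hL : L.det ≠ 0) :
    ∃ U : L2 n ≃ₗᵢ[ℂ] L2 n, IsDilation L m U := by
  have h : LinearMap.det (Matrix.toEuclideanLin L) = L.det := by simp
  refine exists_weighted_linear (Matrix.toEuclideanLin L) (h ▸ hL) _ ?_
  rw [h, norm_mul, norm_zpow, Complex.norm_I, one_zpow, one_mul, Complex.norm_real,
    Real.norm_of_nonneg (Real.sqrt_nonneg _)]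

theorem exists_isFourier (n : ℕ) (hħ : 0 < ħ) : ∃ U : L2 n ≃ₗᵢ[ℂ] L2 n, IsFourier ħ U := by
  -- The unitary transform with kernel `exp(-2πi x · y)` becomes the `ħ`-version after dilation by
  -- `1/(2πħ)`; the prefactor has modulus `a^(n/2)`, which keeps it unitary.
  let a : ℝ := (2 * Real.pi * ħ)⁻¹
  have ha : 0 < a := by positivity
  let L : Config n →ₗ[ℝ] Config n := a • LinearMap.id
  have hdet : LinearMap.det L = a ^ n := by simp [L]
  obtain ⟨V, hV⟩ := exists_weighted_linear L (by rw [hdet]; positivity)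
    ((2 * Real.pi * Complex.I * ħ : ℂ) ^ (-(n : ℂ) / 2)) (by
      have h0 : (2 * Real.pi * Complex.I * ħ : ℂ) ≠ 0 := by
        have := Real.pi_pos.ne'
        have := hħ.ne'
        simp_all
      rw [Complex.norm_cpow_of_ne_zero h0, hdet, abs_of_pos (by positivity)]
      have h1 : (-(n : ℂ) / 2) = ((-(n : ℝ) / 2 : ℝ) : ℂ) := by push_cast; rfl
      rw [h1, Complex.ofReal_im, Complex.ofReal_re, mul_zero, Real.exp_zero, div_one]
      have h2 : ‖(2 * Real.pi * Complex.I * ħ : ℂ)‖ = 2 * Real.pi * ħ := by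
        simp [abs_of_pos Real.pi_pos, abs_of_pos hħ]
      rw [h2, Real.sqrt_eq_rpow, ← Real.rpow_natCast, ← Real.rpow_mul ha.le,
        Real.inv_rpow (by positivity), ← Real.rpow_neg (by positivity)]
      congr 1
      ring)
  have hq : Measure.QuasiMeasurePreserving (fun x : Config n => L x) volume volume := by
    refine ⟨(LinearMap.continuous_of_finiteDimensional L).measurable, ?_⟩
    rw [Measure.map_linearMap_addHaar_eq_smul_addHaar _ (by rw [hdet]; positivity)]
    exact Measure.smul_absolutelyContinuous
  refine ⟨(Lp.fourierTransformₗᵢ (Config n) ℂ).trans V, fun ψ hψ => ?_⟩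
  filter_upwards [hV (Lp.fourierTransformₗᵢ (Config n) ℂ ψ),
    hq.ae (fourierTransform_ae_eq ψ hψ)] with x h1 h2
  rw [LinearIsometryEquiv.trans_apply, h1, h2, Real.fourier_eq']
  congr 1
  refine integral_congr_ae (Filter.Eventually.of_forall fun y => ?_)
  simp only [L, LinearMap.smul_apply, LinearMap.id_apply, inner_smul_right, smul_eq_mul,
    real_inner_comm x y]
  congr 2
  simp only [a]
  have := Real.pi_pos.ne'
  push_cast
  field_simp

/-! ### Generators of the symplectic group -/

section SymplecticGeneration

open Matrix

variable {l : Type*} [Fintype l] [DecidableEq l]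

/-- Otherwise the polynomial `det(A + tC)` vanishes identically, in particular at `t = i`. But `(Aᵀ
- iCᵀ)(A + iC) = AᵀA + CᵀC`, which is invertible because the first block column of a symplectic
matrix is injective. -/
theorem exists_det_add_smul_ne_zero {A B C D : Matrix l l ℝ}
    (h : fromBlocks A B C D ∈ symplecticGroup l ℝ) : ∃ t : ℝ, (A + t • C).det ≠ 0 := by
  obtain ⟨h1, -, h3⟩ := SymplecticGroup.fromBlocks_mem_iff.1 h
  by_contra! hzero
  let p : Polynomial ℝ := (A.map Polynomial.C + (Polynomial.X : Polynomial ℝ) • C.map Polynomial.C).det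
  have hp : p = 0 := by
    refine Polynomial.funext fun t => ?_
    rw [Polynomial.eval_zero, ← hzero t, ← Polynomial.coe_evalRingHom, RingHom.map_det]
    congr 1
    ext i j
    simp
    exact mul_comm _ _
  have hI : (A.map Complex.ofReal + Complex.I • C.map Complex.ofReal).det = 0 := by
    have := congrArg (Polynomial.aeval Complex.I) hp
    rw [map_zero, AlgHom.map_det] at this
    rw [← this]
    congr 1
    ext i j
    simp
    exact mul_comm _ _
  have hpd : (Aᵀ * A + Cᵀ * C).det ≠ 0 := by
    rw [← isUnit_iff_ne_zero, ← isUnit_iff_isUnit_det, ← mulVec_injective_iff_isUnit,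
      ← coe_mulVecLin, ← LinearMap.ker_eq_bot, ker_mulVecLin_eq_bot_iff]
    intro v hv
    have hnn : ∀ w : l → ℝ, 0 ≤ w ⬝ᵥ w := fun w =>
      Finset.sum_nonneg fun i _ => mul_self_nonneg (w i)
    have h0 : (A *ᵥ v) ⬝ᵥ (A *ᵥ v) + (C *ᵥ v) ⬝ᵥ (C *ᵥ v) = 0 := by
      have := congrArg (fun w => v ⬝ᵥ w) hv
      simpa [add_mulVec, ← mulVec_mulVec, dotProduct_add, dotProduct_mulVec, vecMul_transpose]
        using this
    have hA : A *ᵥ v = 0 := dotProduct_self_eq_zero.1 (le_antisymm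
      (by linarith [hnn (C *ᵥ v)]) (hnn _))
    have hC : C *ᵥ v = 0 := dotProduct_self_eq_zero.1 (le_antisymm
      (by linarith [hnn (A *ᵥ v)]) (hnn _))
    -- This relation provides a left inverse of the block column formed by `A` and `C`.
    have h4 : Dᵀ * A - Bᵀ * C = 1 := by simpa using congrArg transpose h3
    rw [← one_mulVec v, ← h4, sub_mulVec, ← mulVec_mulVec, ← mulVec_mulVec, hA, hC]
    simp
  apply hpd
  have h5 : ((Aᵀ * A + Cᵀ * C).map Complex.ofReal).det = 0 := by
    have : (Aᵀ * A + Cᵀ * C).map Complex.ofReal =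
        (Aᵀ.map Complex.ofReal - Complex.I • Cᵀ.map Complex.ofReal) *
          (A.map Complex.ofReal + Complex.I • C.map Complex.ofReal) := by
      have h6 := congrArg (fun N : Matrix l l ℝ => N.map Complex.ofRealHom) h1
      simp only [Matrix.map_mul] at h6
      change (Aᵀ * A + Cᵀ * C).map Complex.ofRealHom =
        (Aᵀ.map Complex.ofRealHom - Complex.I • Cᵀ.map Complex.ofRealHom) *
          (A.map Complex.ofRealHom + Complex.I • C.map Complex.ofRealHom)
      rw [Matrix.map_add _ (map_add _), Matrix.map_mul, Matrix.map_mul, sub_mul, mul_add, mul_add]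
      simp only [Matrix.mul_smul, Matrix.smul_mul, smul_smul, Complex.I_mul_I, neg_smul, one_smul,
        h6]
      abel
    rw [this, det_mul, hI, mul_zero]
  have h7 := RingHom.map_det Complex.ofRealHom (Aᵀ * A + Cᵀ * C)
  exact Complex.ofReal_eq_zero.1 (h7.trans h5)

theorem fromBlocks_lower_mem {P : Matrix l l ℝ} (hP : P.IsSymm) :
    fromBlocks 1 0 P 1 ∈ symplecticGroup l ℝ := by
  simp [SymplecticGroup.fromBlocks_mem_iff, hP.eq]

theorem fromBlocks_upper_mem {P : Matrix l l ℝ} (hP : P.IsSymm) :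
    fromBlocks 1 P 0 1 ∈ symplecticGroup l ℝ := by
  simp [SymplecticGroup.fromBlocks_mem_iff, hP.eq]

theorem fromBlocks_diag_mem {L : Matrix l l ℝ} (hL : L.det ≠ 0) :
    fromBlocks L⁻¹ 0 0 Lᵀ ∈ symplecticGroup l ℝ := by
  simp [SymplecticGroup.fromBlocks_mem_iff, ← transpose_mul, mul_nonsing_inv _ hL.isUnit]

theorem fromBlocks_fourier_mem : fromBlocks 0 1 (-1) 0 ∈ symplecticGroup l ℝ := by
  simp [SymplecticGroup.fromBlocks_mem_iff]

/-- Block LDU decomposition; the symplectic relations force the off-diagonal factors to be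
symmetric. The middle factor is written with `A⁻¹⁻¹` to match the dilation generator for `L = A⁻¹`.
-/
theorem symplectic_factorization {A B C D : Matrix l l ℝ}
    (h : fromBlocks A B C D ∈ symplecticGroup l ℝ) (hA : A.det ≠ 0) :
    (C * A⁻¹).IsSymm ∧ (A⁻¹ * B).IsSymm ∧ fromBlocks A B C D =
      fromBlocks 1 0 (C * A⁻¹) 1 * fromBlocks A⁻¹⁻¹ 0 0 (A⁻¹)ᵀ * fromBlocks 1 (A⁻¹ * B) 0 1 := by
  obtain ⟨h1, h2, h3⟩ := SymplecticGroup.fromBlocks_mem_iff.1 h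
  have hu : IsUnit A.det := hA.isUnit
  have hut : IsUnit Aᵀ.det := by rwa [det_transpose]
  have hQ : (C * A⁻¹)ᵀ = C * A⁻¹ := by
    rw [transpose_mul, transpose_nonsing_inv]
    calc Aᵀ⁻¹ * Cᵀ = Aᵀ⁻¹ * (Cᵀ * A) * A⁻¹ := by
          rw [Matrix.mul_assoc, Matrix.mul_assoc, mul_nonsing_inv _ hu, Matrix.mul_one]
      _ = C * A⁻¹ := by rw [← h1, ← Matrix.mul_assoc, nonsing_inv_mul _ hut, Matrix.one_mul]
  have hD : D = C * A⁻¹ * B + (A⁻¹)ᵀ := by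
    have h4 : Aᵀ * D = 1 + Cᵀ * B := by rw [← h3]; abel
    calc D = Aᵀ⁻¹ * (Aᵀ * D) := by rw [← Matrix.mul_assoc, nonsing_inv_mul _ hut, Matrix.one_mul]
      _ = (C * A⁻¹)ᵀ * B + (A⁻¹)ᵀ := by
        rw [h4, Matrix.mul_add, Matrix.mul_one, transpose_mul, transpose_nonsing_inv,
          Matrix.mul_assoc, add_comm]
      _ = _ := by rw [hQ]
  refine ⟨hQ, ?_, ?_⟩
  · have h5 : Dᵀ = Bᵀ * (C * A⁻¹) + A⁻¹ := by
      rw [hD, transpose_add, transpose_mul, hQ, transpose_transpose]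
    rw [h5, hD, Matrix.mul_add, Matrix.add_mul, ← Matrix.mul_assoc, ← Matrix.mul_assoc] at h2
    have h6 := add_left_cancel h2
    rw [Matrix.IsSymm, transpose_mul, h6]
  · rw [nonsing_inv_nonsing_inv _ hu]
    simp only [fromBlocks_multiply, Matrix.one_mul, Matrix.zero_mul, Matrix.mul_zero, add_zero,
      Matrix.mul_one, zero_add]
    rw [← Matrix.mul_assoc, mul_nonsing_inv _ hu, Matrix.one_mul, Matrix.mul_assoc C,
      nonsing_inv_mul _ hu, Matrix.mul_one, ← Matrix.mul_assoc, hD]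

/-- The symplectic group is generated by lower unipotent, block diagonal and Fourier matrices. -/
theorem eq_top_of_symplectic_generators (H : Subgroup (symplecticGroup l ℝ))
    (hlower : ∀ P (hP : P.IsSymm), ⟨fromBlocks 1 0 P 1, fromBlocks_lower_mem hP⟩ ∈ H)
    (hdiag : ∀ L (hL : L.det ≠ 0), ⟨fromBlocks L⁻¹ 0 0 Lᵀ, fromBlocks_diag_mem hL⟩ ∈ H)
    (hfourier : ⟨fromBlocks 0 1 (-1) 0, fromBlocks_fourier_mem⟩ ∈ H) : H = ⊤ := by
  have hupper : ∀ P (hP : P.IsSymm), ⟨fromBlocks 1 P 0 1, fromBlocks_upper_mem hP⟩ ∈ H := by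
    -- Conjugation by the Fourier matrix turns the lower unipotent of `-P` into the upper unipotent
    -- of `P`.
    intro P hP
    have hmem := H.mul_mem (H.mul_mem hfourier (hlower (-P) hP.neg)) (H.inv_mem hfourier)
    convert hmem using 1
    rw [eq_mul_inv_iff_mul_eq]
    apply Subtype.ext
    simp [fromBlocks_multiply]
  have hunit : ∀ A B C D (h : fromBlocks A B C D ∈ symplecticGroup l ℝ), A.det ≠ 0 →
      ⟨fromBlocks A B C D, h⟩ ∈ H := by
    intro A B C D h hA
    obtain ⟨hQ, hR, hfac⟩ := symplectic_factorization h hA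
    have hA' : (A⁻¹).det ≠ 0 := by
      rw [det_nonsing_inv, Ring.inverse_eq_inv']; exact inv_ne_zero hA
    have hmem := H.mul_mem (H.mul_mem (hlower _ hQ) (hdiag _ hA')) (hupper _ hR)
    convert hmem using 1
    exact Subtype.ext hfac
  refine (Subgroup.eq_top_iff' H).2 fun S => ?_
  obtain ⟨S, hS⟩ := S
  rw [← fromBlocks_toBlocks S] at hS
  obtain ⟨t, ht⟩ := exists_det_add_smul_ne_zero hS
  have hsym : (t • (1 : Matrix l l ℝ)).IsSymm := isSymm_one.smul t
  -- Left multiplication by an upper unipotent replaces the corner `A` by the invertible `A + tC`.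
  rw [← H.mul_mem_cancel_left (hupper _ hsym)]
  have heq : fromBlocks 1 (t • (1 : Matrix l l ℝ)) 0 1 * S =
      fromBlocks (S.toBlocks₁₁ + t • S.toBlocks₂₁) (S.toBlocks₁₂ + t • S.toBlocks₂₂)
        S.toBlocks₂₁ S.toBlocks₂₂ := by
    nth_rw 1 [← fromBlocks_toBlocks S]
    simp [fromBlocks_multiply]
  have hS' : S ∈ symplecticGroup l ℝ := by rwa [fromBlocks_toBlocks] at hS
  have hmem := mul_mem (fromBlocks_upper_mem hsym) hS'
  rw [heq] at hmem
  convert hunit _ _ _ _ hmem ht using 1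
  exact Subtype.ext heq

end SymplecticGeneration

/-! ### Surjectivity of the covering projection -/

theorem exists_covers (hħ : 0 < ħ) (S : Matrix.symplecticGroup (Fin n) ℝ) :
    ∃ Shat : metaplecticGroup n ħ, Covers ħ Shat S := by
  have htop : (metaplecticGraph n ħ).map (MonoidHom.snd _ _) = ⊤ := by
    refine eq_top_of_symplectic_generators _ (fun P hP => ?_) (fun L hL => ?_) ?_
    · obtain ⟨U, hU⟩ := exists_isChirp ħ P
      exact ⟨(U, ⟨_, _⟩), Subgroup.subset_closure (show IsGenerator ħ _ _ from .chirp P hP U hU), rfl⟩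
    · rcases lt_or_gt_of_ne hL with hneg | hpos
      · obtain ⟨U, hU⟩ := exists_isDilation L 1 hL
        exact ⟨(U, ⟨_, _⟩), Subgroup.subset_closure
          (show IsGenerator ħ _ _ from .dilation L 1 (Or.inr ⟨odd_one, hneg⟩) U hU), rfl⟩
      · obtain ⟨U, hU⟩ := exists_isDilation L 0 hL
        exact ⟨(U, ⟨_, _⟩), Subgroup.subset_closure
          (show IsGenerator ħ _ _ from .dilation L 0 (Or.inl ⟨Even.zero, hpos⟩) U hU), rfl⟩
    · obtain ⟨U, hU⟩ := exists_isFourier n hħ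
      exact ⟨(U, ⟨_, _⟩), Subgroup.subset_closure (show IsGenerator ħ _ _ from .fourier U hU), rfl⟩
  have hS : S ∈ (metaplecticGraph n ħ).map (MonoidHom.snd _ _) := htop ▸ Subgroup.mem_top S
  obtain ⟨⟨U, S'⟩, hg, rfl⟩ := hS
  exact ⟨⟨U, ⟨(U, S'), hg, rfl⟩⟩, hg⟩

/-! ### Reflection operators and symplectic covariance of the Wigner transform -/

theorem act_mul (S T : Matrix (Fin n ⊕ Fin n) (Fin n ⊕ Fin n) ℝ) (z : Phase n) :
    act (S * T) z = act S (act T z) := by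
  simp [act, Matrix.toLpLin_apply, Matrix.mulVec_mulVec]

theorem act_one (z : Phase n) : act 1 z = z := by
  simp [act]

theorem position_act_fromBlocks (A B C D : Matrix (Fin n) (Fin n) ℝ) (z : Phase n) :
    position (act (Matrix.fromBlocks A B C D) z) =
      Matrix.toEuclideanLin A (position z) + Matrix.toEuclideanLin B (momentum z) := by
  ext i
  simp [position, momentum, act, Matrix.toLpLin_apply, Matrix.mulVec, dotProduct]

theorem momentum_act_fromBlocks (A B C D : Matrix (Fin n) (Fin n) ℝ) (z : Phase n) :
    momentum (act (Matrix.fromBlocks A B C D) z) =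
      Matrix.toEuclideanLin C (position z) + Matrix.toEuclideanLin D (momentum z) := by
  ext i
  simp [position, momentum, act, Matrix.toLpLin_apply, Matrix.mulVec, dotProduct]

theorem exists_reflection (ħ : ℝ) (z : Phase n) : ∃ U : L2 n ≃ₗᵢ[ℂ] L2 n, ∀ ψ : L2 n,
    U ψ =ᵐ[volume] fun u => Complex.exp (2 * Complex.I / ħ *
      (inner ℝ (momentum z) (u - position z) : ℝ)) * ψ ((2 : ℝ) • position z - u) := by
  refine exists_weighted_comp (MeasurableEquiv.subLeft ((2 : ℝ) • position z))
    (m := fun u => Complex.exp (2 * Complex.I / ħ *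
      (inner ℝ (momentum z) (u - position z) : ℝ))) ?_ one_pos (fun x => ?_) ?_
  · fun_prop
  · rw [Complex.norm_exp]
    have : 2 * Complex.I / ħ * (inner ℝ (momentum z) (x - position z) : ℝ)
      = ((2 * inner ℝ (momentum z) (x - position z) / ħ : ℝ) : ℂ) * Complex.I := by
      push_cast; ring
    rw [this, Complex.re_ofReal_mul, Complex.I_re, mul_zero, Real.exp_zero]
  · rw [one_pow, inv_one, ENNReal.ofReal_one, one_smul]
    exact (Measure.measurePreserving_sub_left volume _).map_eq

/-- The Grossmann–Royer reflection operator at `z`. -/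
def reflection (ħ : ℝ) (z : Phase n) : L2 n ≃ₗᵢ[ℂ] L2 n := (exists_reflection ħ z).choose

theorem reflection_ae_eq (ħ : ℝ) (z : Phase n) (ψ : L2 n) :
    reflection ħ z ψ =ᵐ[volume] fun u => Complex.exp (2 * Complex.I / ħ *
      (inner ℝ (momentum z) (u - position z) : ℝ)) * ψ ((2 : ℝ) • position z - u) :=
  (exists_reflection ħ z).choose_spec ψ

/-- The substitution `u = x + y/2` turns `x - y/2` into `2x - u`; its Jacobian is the factor `2 ^
n`. -/
theorem wignerMoyal_eq_inner_reflection (ħ : ℝ) (ψ φ : L2 n) (z : Phase n) :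
    wignerMoyal ħ ψ φ z =
      (1 / (2 * Real.pi * ħ : ℂ)) ^ n * (2 ^ n * inner ℂ (reflection ħ z φ) ψ) := by
  rw [wignerMoyal, L2.inner_def]
  congr 1
  let G : Config n → ℂ := fun u => Complex.exp (-(2 * Complex.I / ħ) *
    (inner ℝ (momentum z) (u - position z) : ℝ)) * ψ u *
      (starRingEnd ℂ) (φ ((2 : ℝ) • position z - u))
  have h1 : ∫ u, inner ℂ (reflection ħ z φ u) (ψ u) = ∫ u, G u := by
    refine integral_congr_ae ?_
    filter_upwards [reflection_ae_eq ħ z φ] with u hu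
    simp only [hu, G, RCLike.inner_apply, map_mul, ← Complex.exp_conj, map_div₀, Complex.conj_I,
      Complex.conj_ofReal, map_ofNat]
    ring_nf
  rw [h1, ← integral_add_left_eq_self G (position z)]
  have h2 := Measure.integral_comp_smul (volume : Measure (Config n))
    (fun u => G (position z + u)) (1 / 2 : ℝ)
  have h3 : |((1 / 2 : ℝ) ^ n)⁻¹| = 2 ^ n := by
    rw [abs_of_pos (by positivity)]; simp
  rw [finrank_euclideanSpace_fin, h3, Complex.real_smul] at h2
  push_cast at h2
  rw [← h2]
  refine integral_congr_ae (Filter.Eventually.of_forall fun y => ?_)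
  simp only [G, add_sub_cancel_left, inner_smul_right]
  have h4 : (2 : ℝ) • position z - (position z + (1 / 2 : ℝ) • y) =
    position z - (1 / 2 : ℝ) • y := by rw [two_smul]; abel
  rw [h4]
  congr 3
  push_cast
  ring

theorem wigner_eq_of_intertwines {U : L2 n ≃ₗᵢ[ℂ] L2 n} {z w : Phase n}
    (h : ∀ φ, reflection ħ w (U φ) = U (reflection ħ z φ)) (ψ : L2 n) :
    wigner ħ (U ψ) w = wigner ħ ψ z := by
  rw [wigner, wigner, wignerMoyal_eq_inner_reflection, wignerMoyal_eq_inner_reflection, h,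
    U.inner_map_map]

theorem IsChirp.intertwines {P : Matrix (Fin n) (Fin n) ℝ} (hP : P.IsSymm)
    {U : L2 n ≃ₗᵢ[ℂ] L2 n} (hU : IsChirp ħ P U) (z : Phase n) (φ : L2 n) :
    reflection ħ (act (Matrix.fromBlocks 1 0 P 1) z) (U φ) = U (reflection ħ z φ) := by
  have hq := (Measure.measurePreserving_sub_left (volume : Measure (Config n))
    ((2 : ℝ) • position z)).quasiMeasurePreserving
  apply Lp.ext
  have hx : position (act (Matrix.fromBlocks 1 0 P 1) z) = position z := by
    simp [position_act_fromBlocks]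
  have hp : momentum (act (Matrix.fromBlocks 1 0 P 1) z) =
      Matrix.toEuclideanLin P (position z) + momentum z := by
    simp [momentum_act_fromBlocks]
  have h0 := reflection_ae_eq ħ (act (Matrix.fromBlocks 1 0 P 1) z) (U φ)
  rw [hx, hp] at h0
  filter_upwards [h0, hq.ae (hU φ), hU (reflection ħ z φ), reflection_ae_eq ħ z φ]
    with u h1 h2 h3 h4
  rw [h1, h2, h3, h4, ← mul_assoc, ← mul_assoc, ← Complex.exp_add, ← Complex.exp_add]
  congr 2
  have hs : ∀ a b, inner ℝ (Matrix.toEuclideanLin P a) b = inner ℝ (Matrix.toEuclideanLin P b) a := by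
    intro a b
    have hH : P.IsHermitian := by rwa [Matrix.IsHermitian, Matrix.conjTranspose_eq_transpose_of_trivial]
    rw [Matrix.isSymmetric_toEuclideanLin_iff.2 hH a b, real_inner_comm]
  simp only [map_sub, map_smul, inner_sub_left, inner_sub_right, inner_smul_left, inner_smul_right,
    inner_add_left, hs u (position z)]
  push_cast
  simp only [RCLike.conj_to_real]
  push_cast
  ring

theorem IsDilation.intertwines {L : Matrix (Fin n) (Fin n) ℝ} (hL : L.det ≠ 0) {m : ℤ}
    {U : L2 n ≃ₗᵢ[ℂ] L2 n} (hU : IsDilation L m U) (z : Phase n) (φ : L2 n) :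
    reflection ħ (act (Matrix.fromBlocks L⁻¹ 0 0 L.transpose) z) (U φ) =
      U (reflection ħ z φ) := by
  have hx : position (act (Matrix.fromBlocks L⁻¹ 0 0 L.transpose) z) =
      Matrix.toEuclideanLin L⁻¹ (position z) := by
    simp [position_act_fromBlocks]
  have hp : momentum (act (Matrix.fromBlocks L⁻¹ 0 0 L.transpose) z) =
      Matrix.toEuclideanLin L.transpose (momentum z) := by
    simp [momentum_act_fromBlocks]
  have hq := (Measure.measurePreserving_sub_left (volume : Measure (Config n))
    ((2 : ℝ) • Matrix.toEuclideanLin L⁻¹ (position z))).quasiMeasurePreserving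
  have hdet : LinearMap.det (Matrix.toEuclideanLin L) = L.det := by simp
  have hqL : Measure.QuasiMeasurePreserving (fun x : Config n => Matrix.toEuclideanLin L x)
      volume volume := by
    refine ⟨(LinearMap.continuous_of_finiteDimensional _).measurable, ?_⟩
    rw [Measure.map_linearMap_addHaar_eq_smul_addHaar _ (hdet ▸ hL)]
    exact Measure.smul_absolutelyContinuous
  have hLL : ∀ x : Config n, Matrix.toEuclideanLin L (Matrix.toEuclideanLin L⁻¹ x) = x := by
    intro x
    simp [Matrix.toLpLin_apply, Matrix.mulVec_mulVec, Matrix.mul_nonsing_inv _ hL.isUnit]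
  have hadj : ∀ a b : Config n, inner ℝ (Matrix.toEuclideanLin L.transpose a) b =
      inner ℝ a (Matrix.toEuclideanLin L b) := by
    intro a b
    rw [← Matrix.conjTranspose_eq_transpose_of_trivial, Matrix.toEuclideanLin_conjTranspose_eq_adjoint,
      LinearMap.adjoint_inner_left]
  have h0 := reflection_ae_eq ħ (act (Matrix.fromBlocks L⁻¹ 0 0 L.transpose) z) (U φ)
  rw [hx, hp] at h0
  apply Lp.ext
  filter_upwards [h0, hq.ae (hU φ), hU (reflection ħ z φ), hqL.ae (reflection_ae_eq ħ z φ)]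
    with u h1 h2 h3 h4
  rw [h1, h2, h3, h4, hadj, map_sub, map_sub, map_smul, hLL]
  ring

theorem IsFourier.intertwines {U : L2 n ≃ₗᵢ[ℂ] L2 n} (hU : IsFourier ħ U) (z : Phase n)
    (φ : L2 n) :
    reflection ħ (act (Matrix.fromBlocks 0 1 (-1) 0) z) (U φ) = U (reflection ħ z φ) := by
  have hx : position (act (Matrix.fromBlocks 0 1 (-1) 0) z) = momentum z := by
    simp [position_act_fromBlocks]
  have hp : momentum (act (Matrix.fromBlocks 0 1 (-1) 0) z) = -position z := by
    simp [momentum_act_fromBlocks]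
  -- The integral formula holds only for integrable functions, so the identity is proved for
  -- Schwartz functions and extended by continuity.
  refine DenseRange.induction_on (SchwartzMap.denseRange_toLpCLM (p := 2) (F := ℂ)
    (μ := (volume : Measure (Config n))) ENNReal.ofNat_ne_top) φ
    (isClosed_eq (by fun_prop) (by fun_prop)) fun f => ?_
  set ψ : L2 n := SchwartzMap.toLpCLM ℝ (E := Config n) ℂ 2 volume f with hψ
  have hint : Integrable ψ volume := f.integrable.congr (f.coeFn_toLp 2 volume).symm
  have hR := reflection_ae_eq ħ z ψ
  have hintR : Integrable (reflection ħ z ψ) volume := by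
    refine Integrable.congr ?_ hR.symm
    refine (hint.comp_sub_left ((2 : ℝ) • position z)).bdd_mul (c := 1)
      (by fun_prop) (Filter.Eventually.of_forall fun u => ?_)
    have : 2 * Complex.I / ħ * (inner ℝ (momentum z) (u - position z) : ℝ)
      = ((2 * inner ℝ (momentum z) (u - position z) / ħ : ℝ) : ℂ) * Complex.I := by
      push_cast; ring
    rw [this, Complex.norm_exp_ofReal_mul_I]
  have hq := (Measure.measurePreserving_sub_left (volume : Measure (Config n))
    ((2 : ℝ) • momentum z)).quasiMeasurePreserving
  have h0 := reflection_ae_eq ħ (act (Matrix.fromBlocks 0 1 (-1) 0) z) (U ψ)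
  rw [hx, hp] at h0
  apply Lp.ext
  filter_upwards [h0, hq.ae (hU ψ hint), hU _ hintR] with u h1 h2 h3
  rw [h1, h2, h3, mul_left_comm]
  congr 1
  -- The change of variable `y ↦ 2x - y` undoes the reflection under the Fourier integral.
  rw [← integral_const_mul, ← integral_sub_left_eq_self _ volume ((2 : ℝ) • position z)]
  refine integral_congr_ae ?_
  filter_upwards [hR] with y hy
  rw [hy, ← mul_assoc, ← mul_assoc, ← Complex.exp_add, ← Complex.exp_add]
  congr 2
  simp only [inner_sub_left, inner_sub_right, inner_smul_left, inner_smul_right, inner_neg_left,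
    real_inner_comm (position z) u,
    real_inner_comm (momentum z) (position z), RCLike.conj_to_real]
  push_cast
  ring

theorem intertwines_of_mem_metaplecticGraph
    {g : (L2 n ≃ₗᵢ[ℂ] L2 n) × Matrix.symplecticGroup (Fin n) ℝ}
    (hg : g ∈ metaplecticGraph n ħ) (z : Phase n) (φ : L2 n) :
    reflection ħ (act (g.2 : Matrix (Fin n ⊕ Fin n) (Fin n ⊕ Fin n) ℝ) z) (g.1 φ) =
      g.1 (reflection ħ z φ) := by
  induction hg using Subgroup.closure_induction generalizing z φ with
  | mem g hg =>
    obtain ⟨U, S, hS⟩ := g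
    change IsGenerator ħ U S at hg
    change reflection ħ (act S z) (U φ) = U (reflection ħ z φ)
    cases hg with
    | chirp P hP _ hU => exact hU.intertwines hP z φ
    | dilation L m hm _ hU =>
      exact hU.intertwines (hm.elim (fun h => h.2.ne') fun h => h.2.ne) z φ
    | fourier _ hU => exact hU.intertwines z φ
  | one => simp [act_one]
  | mul g h _ _ ihg ihh =>
    simp only [Prod.snd_mul, Prod.fst_mul, Submonoid.coe_mul, act_mul, LinearIsometryEquiv.coe_mul,
      Function.comp_apply, ihg, ihh]
  | inv g _ ih =>
    -- After applying `g.1`, the claim is the induction hypothesis at the point `g⁻¹z`.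
    rw [← g.1.injective.eq_iff, ← ih]
    have hS : act (g.2 : Matrix (Fin n ⊕ Fin n) (Fin n ⊕ Fin n) ℝ)
        (act ((g⁻¹).2 : Matrix (Fin n ⊕ Fin n) (Fin n ⊕ Fin n) ℝ) z) = z := by
      rw [← act_mul, ← Submonoid.coe_mul, Prod.snd_inv, mul_inv_cancel, Submonoid.coe_one, act_one]
    have hU : ∀ χ, g.1 ((g⁻¹).1 χ) = χ := fun χ => by
      
      exact g.1.apply_symm_apply χ
    rw [hS, hU, hU]

theorem wigner_covers {Shat : metaplecticGroup n ħ} {S : Matrix.symplecticGroup (Fin n) ℝ}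
    (h : Covers ħ Shat S) (ψ : L2 n) (z : Phase n) :
    wigner ħ ((Shat : L2 n ≃ₗᵢ[ℂ] L2 n) ψ)
      (act (S : Matrix (Fin n ⊕ Fin n) (Fin n ⊕ Fin n) ℝ) z) = wigner ħ ψ z :=
  wigner_eq_of_intertwines (intertwines_of_mem_metaplecticGraph h z) ψ

/-! ### Gaussian averages of the Wigner transform -/

/-- The phase space point with position `x` and momentum `p`. -/
def phasePoint (x p : Config n) : Phase n := WithLp.toLp 2 (Sum.elim x p)

@[simp] theorem position_phasePoint (x p : Config n) : position (phasePoint x p) = x := rfl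

@[simp] theorem momentum_phasePoint (x p : Config n) : momentum (phasePoint x p) = p := rfl

theorem norm_sq_phasePoint (x p : Config n) : ‖phasePoint x p‖ ^ 2 = ‖x‖ ^ 2 + ‖p‖ ^ 2 := by
  simp [EuclideanSpace.norm_sq_eq, phasePoint]

/-- With `v = x - y/2` the other argument is `2x - v`, so the integral is a convolution at `2x`.
Integrability and factorization of the iterated integral then follow from the theory of
convolutions. -/
theorem integral_half_sum_diff (A B : Config n → ℂ) (x : Config n) :
    ∫ y, A (x + (1 / 2 : ℝ) • y) * B (x - (1 / 2 : ℝ) • y) =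
      2 ^ n * convolution B A (ContinuousLinearMap.mul ℂ ℂ) volume ((2 : ℝ) • x) := by
  have h1 := Measure.integral_comp_smul (volume : Measure (Config n))
    (fun u => A (x + u) * B (x - u)) (1 / 2 : ℝ)
  have h3 : |((1 / 2 : ℝ) ^ n)⁻¹| = 2 ^ n := by
    rw [abs_of_pos (by positivity)]; simp
  rw [finrank_euclideanSpace_fin, h3, Complex.real_smul] at h1
  push_cast at h1
  rw [h1, ← integral_sub_left_eq_self _ volume x, convolution]
  congr 1
  refine integral_congr_ae (Filter.Eventually.of_forall fun v => ?_)
  simp only [sub_sub_cancel, ContinuousLinearMap.mul_apply', two_smul, add_sub_assoc]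
  ring

theorem integrable_integral_half_sum_diff {A B : Config n → ℂ} (hA : Integrable A)
    (hB : Integrable B) :
    Integrable fun x => ∫ y, A (x + (1 / 2 : ℝ) • y) * B (x - (1 / 2 : ℝ) • y) := by
  simp only [integral_half_sum_diff]
  exact ((hB.integrable_convolution _ hA).comp_smul two_ne_zero).const_mul _

theorem integral_integral_half_sum_diff {A B : Config n → ℂ} (hA : Integrable A)
    (hB : Integrable B) :
    ∫ x, ∫ y, A (x + (1 / 2 : ℝ) • y) * B (x - (1 / 2 : ℝ) • y) = (∫ u, A u) * ∫ v, B v := by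
  simp only [integral_half_sum_diff]
  rw [integral_const_mul, Measure.integral_comp_smul, integral_convolution _ hB hA,
    finrank_euclideanSpace_fin, abs_of_pos (by positivity), Complex.real_smul,
    ContinuousLinearMap.mul_apply']
  push_cast
  rw [mul_inv_cancel_left₀ (pow_ne_zero _ two_ne_zero), mul_comm]

theorem integrable_wigner_kernel (ψ : L2 n) (x : Config n) :
    Integrable fun y : Config n =>
      ψ (x + (1 / 2 : ℝ) • y) * (starRingEnd ℂ) (ψ (x - (1 / 2 : ℝ) • y)) := by
  have h1 : MemLp (fun u => (starRingEnd ℂ) (ψ ((2 : ℝ) • x - u))) 2 volume :=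
    ((Lp.memLp ψ).comp_measurePreserving
      (Measure.measurePreserving_sub_left volume ((2 : ℝ) • x))).star
  have h2 : Integrable (fun u => ψ u * (starRingEnd ℂ) (ψ ((2 : ℝ) • x - u))) :=
    (Lp.memLp ψ).integrable_mul h1
  have h3 := (h2.comp_add_left x).comp_smul (R := (1 / 2 : ℝ)) (by norm_num)
  refine h3.congr (Filter.Eventually.of_forall fun y => ?_)
  simp only [two_smul]
  congr 3
  abel

theorem integral_gaussian_character (hħ : 0 < ħ) (q y : Config n) :
    ∫ p : Config n, Complex.exp (-(1 / ħ) * ‖p - q‖ ^ 2) *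
        Complex.exp (-(Complex.I / ħ) * (inner ℝ p y : ℝ)) =
      ((Real.pi * ħ) ^ ((n : ℝ) / 2) : ℝ) * (Complex.exp (-(Complex.I / ħ) * (inner ℝ q y : ℝ)) *
        Complex.exp (-(1 / (4 * ħ)) * ‖y‖ ^ 2)) := by
  have hħ' : (ħ : ℂ) ≠ 0 := by exact_mod_cast hħ.ne'
  have h := GaussianFourier.integral_cexp_neg_mul_sq_norm_add (V := Config n)
    (b := ((1 / ħ : ℝ) : ℂ)) (by rw [Complex.ofReal_re]; positivity) (-(Complex.I / ħ)) y
  have hc : ((Real.pi : ℂ) / ((1 / ħ : ℝ) : ℂ)) ^ ((n : ℂ) / 2) =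
      ((Real.pi * ħ) ^ ((n : ℝ) / 2) : ℝ) := by
    rw [Complex.ofReal_cpow (by positivity)]
    push_cast
    congr 1
    field_simp
  rw [finrank_euclideanSpace_fin, hc] at h
  rw [← integral_add_right_eq_self _ q]
  have h2 : ∀ p : Config n, Complex.exp (-(1 / ħ) * ‖p + q - q‖ ^ 2) *
      Complex.exp (-(Complex.I / ħ) * (inner ℝ (p + q) y : ℝ)) =
      Complex.exp (-(Complex.I / ħ) * (inner ℝ q y : ℝ)) *
      Complex.exp (-((1 / ħ : ℝ) : ℂ) * ‖p‖ ^ 2 + -(Complex.I / ħ) * (inner ℝ y p : ℝ)) := by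
    intro p
    rw [← Complex.exp_add, ← Complex.exp_add, add_sub_cancel_right, inner_add_left,
      real_inner_comm p y]
    congr 1
    push_cast
    ring
  simp only [h2]
  rw [integral_const_mul, h, mul_left_comm]
  congr 3
  rw [neg_sq, div_pow, Complex.I_sq]
  push_cast
  field_simp

theorem integrable_gaussian (hħ : 0 < ħ) (q : Config n) :
    Integrable fun p : Config n => Complex.exp (-(1 / ħ) * ‖p - q‖ ^ 2) := by
  have h := (GaussianFourier.integrable_cexp_neg_mul_sq_norm_add (V := Config n)
    (b := ((1 / ħ : ℝ) : ℂ)) (by rw [Complex.ofReal_re]; positivity) 0 0).comp_sub_right q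
  refine h.congr (Filter.Eventually.of_forall fun p => ?_)
  simp

theorem norm_character (ħ r : ℝ) : ‖Complex.exp (-(Complex.I / ħ) * r)‖ = 1 := by
  have : -(Complex.I / ħ) * r = ((-(r / ħ) : ℝ) : ℂ) * Complex.I := by push_cast; ring
  rw [this, Complex.norm_exp_ofReal_mul_I]

theorem integrable_gaussian_mul_kernel (hħ : 0 < ħ) (q : Config n) {k : Config n → ℂ}
    (hk : Integrable k) :
    Integrable (fun z : Config n × Config n => Complex.exp (-(1 / ħ) * ‖z.1 - q‖ ^ 2) *
      (Complex.exp (-(Complex.I / ħ) * (inner ℝ z.1 z.2 : ℝ)) * k z.2))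
      ((volume : Measure (Config n)).prod volume) := by
  have h := (integrable_gaussian hħ q).mul_prod hk
  have h2 := h.bdd_mul (f := fun z : Config n × Config n =>
    Complex.exp (-(Complex.I / ħ) * (inner ℝ z.1 z.2 : ℝ))) (c := 1)
    (Continuous.aestronglyMeasurable (by fun_prop))
    (Filter.Eventually.of_forall fun z => (norm_character ħ _).le)
  refine h2.congr (Filter.Eventually.of_forall fun z => ?_)
  ring

/-- Fubini: the Gaussian in `p` makes the oscillatory double integral absolutely convergent, and
integrating out `p` leaves a Gaussian cutoff in `y`. -/
theorem integral_gaussian_mul_kernel (hħ : 0 < ħ) (q : Config n) {k : Config n → ℂ}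
    (hk : Integrable k) :
    ∫ p : Config n, Complex.exp (-(1 / ħ) * ‖p - q‖ ^ 2) *
        ∫ y, Complex.exp (-(Complex.I / ħ) * (inner ℝ p y : ℝ)) * k y =
      ((Real.pi * ħ) ^ ((n : ℝ) / 2) : ℝ) * ∫ y, Complex.exp (-(Complex.I / ħ) * (inner ℝ q y : ℝ)) *
        Complex.exp (-(1 / (4 * ħ)) * ‖y‖ ^ 2) * k y := by
  simp only [← integral_const_mul]
  rw [integral_integral_swap (integrable_gaussian_mul_kernel hħ q hk)]
  refine integral_congr_ae (Filter.Eventually.of_forall fun y => ?_)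
  simp only [← mul_assoc]
  rw [integral_mul_const, integral_gaussian_character hħ]
  ring

/-- The product of `ψ` with the conjugate of the Gaussian wave packet centred at `(x, p)`. -/
def packetProduct (ħ : ℝ) (x p : Config n) (ψ : L2 n) (u : Config n) : ℂ :=
  ψ u * (Complex.exp (-(Complex.I / ħ) * (inner ℝ p u : ℝ)) *
    Complex.exp (-(1 / (2 * ħ)) * ‖u - x‖ ^ 2))

theorem memLp_gaussian (hħ : 0 < ħ) (w : Config n) :
    MemLp (fun u : Config n => Complex.exp (-(1 / (2 * ħ)) * ‖u‖ ^ 2 + (inner ℝ w u : ℝ))) 2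
      volume := by
  rw [memLp_two_iff_integrable_sq_norm (Continuous.aestronglyMeasurable (by fun_prop))]
  refine (GaussianFourier.integrable_cexp_neg_mul_sq_norm_add (V := Config n)
    (b := ((1 / ħ : ℝ) : ℂ)) (by rw [Complex.ofReal_re]; positivity) 2 w).norm.congr
    (Filter.Eventually.of_forall fun u => ?_)
  simp only [Complex.norm_exp]
  rw [← Real.exp_nat_mul]
  congr 1
  have h1 : -((1 / ħ : ℝ) : ℂ) * (‖u‖ : ℂ) ^ 2 + 2 * ((inner ℝ w u : ℝ) : ℂ) =
      ((-(1 / ħ) * ‖u‖ ^ 2 + 2 * inner ℝ w u : ℝ) : ℂ) := by push_cast; ring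
  have h2 : -(1 / (2 * ħ : ℂ)) * (‖u‖ : ℂ) ^ 2 + ((inner ℝ w u : ℝ) : ℂ) =
      ((-(1 / (2 * ħ)) * ‖u‖ ^ 2 + inner ℝ w u : ℝ) : ℂ) := by push_cast; ring
  rw [h1, h2, Complex.ofReal_re, Complex.ofReal_re]
  push_cast
  field_simp

theorem integrable_mul_gaussian (hħ : 0 < ħ) (ψ : L2 n) (w : Config n) :
    Integrable fun u : Config n =>
      ψ u * Complex.exp (-(1 / (2 * ħ)) * ‖u‖ ^ 2 + (inner ℝ w u : ℝ)) :=
  (Lp.memLp ψ).integrable_mul (memLp_gaussian hħ w)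

theorem norm_sub_sq_div (x u : Config n) :
    -(1 / (2 * ħ : ℂ)) * (‖u - x‖ : ℂ) ^ 2 =
      (-(1 / (2 * ħ)) * ‖u‖ ^ 2 + (inner ℝ ((1 / ħ : ℝ) • x) u : ℝ)) +
        -(1 / (2 * ħ)) * ‖x‖ ^ 2 := by
  have h := norm_sub_sq_real u x
  have h' : (‖u - x‖ : ℂ) ^ 2 = ‖u‖ ^ 2 - 2 * (inner ℝ x u : ℝ) + ‖x‖ ^ 2 := by
    rw [real_inner_comm] at h; exact_mod_cast h
  rw [h', inner_smul_left, RCLike.conj_to_real]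
  push_cast
  ring

theorem integrable_packetProduct (hħ : 0 < ħ) (x p : Config n) (ψ : L2 n) :
    Integrable (packetProduct ħ x p ψ) := by
  have h := ((integrable_mul_gaussian hħ ψ ((1 / ħ : ℝ) • x)).mul_const
    (Complex.exp (-(1 / (2 * ħ)) * ‖x‖ ^ 2))).bdd_mul (f := fun u : Config n =>
    Complex.exp (-(Complex.I / ħ) * (inner ℝ p u : ℝ))) (c := 1)
    (Continuous.aestronglyMeasurable (by fun_prop))
    (Filter.Eventually.of_forall fun z => (norm_character ħ _).le)
  refine h.congr (Filter.Eventually.of_forall fun u => ?_)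
  simp only [packetProduct, norm_sub_sq_div x u, Complex.exp_add]
  ring

/-- By the parallelogram law, the two packet Gaussians at `a ± y/2` combine into one in `a` and one
in `y`, the latter being the cutoff produced by the momentum average. -/
theorem packetProduct_mul_conj (x p : Config n) (ψ : L2 n) (a y : Config n) :
    packetProduct ħ x p ψ (a + (1 / 2 : ℝ) • y) *
        (starRingEnd ℂ) (packetProduct ħ x p ψ (a - (1 / 2 : ℝ) • y)) =
      Complex.exp (-(1 / ħ) * ‖a - x‖ ^ 2) * (Complex.exp (-(Complex.I / ħ) * (inner ℝ p y : ℝ)) *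
        Complex.exp (-(1 / (4 * ħ)) * ‖y‖ ^ 2) *
        (ψ (a + (1 / 2 : ℝ) • y) * (starRingEnd ℂ) (ψ (a - (1 / 2 : ℝ) • y)))) := by
  have h := parallelogram_law_with_norm ℝ (a - x) ((1 / 2 : ℝ) • y)
  have h' : (‖a + (1 / 2 : ℝ) • y - x‖ : ℂ) ^ 2 =
      2 * ‖a - x‖ ^ 2 + ‖y‖ ^ 2 / 2 - ‖a - (1 / 2 : ℝ) • y - x‖ ^ 2 := by
    rw [norm_smul, sub_add_eq_add_sub, sub_right_comm] at h
    norm_num at h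
    have h2 : ‖a + (1 / 2 : ℝ) • y - x‖ ^ 2 =
      2 * ‖a - x‖ ^ 2 + ‖y‖ ^ 2 / 2 - ‖a - (1 / 2 : ℝ) • y - x‖ ^ 2 := by linarith
    exact_mod_cast h2
  simp only [packetProduct, map_mul, ← Complex.exp_conj, map_neg, map_div₀, map_pow, map_one,
    map_ofNat, Complex.conj_I, Complex.conj_ofReal, inner_add_right, inner_sub_right,
    inner_smul_right, h']
  have key : ∀ a b c d e f g s t : ℂ, a + b + c + d = e + f + g →
      s * (Complex.exp a * Complex.exp b) * (t * (Complex.exp c * Complex.exp d)) =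
      Complex.exp e * (Complex.exp f * Complex.exp g * (s * t)) := by
    intro a b c d e f g s t hh
    have : Complex.exp a * Complex.exp b * Complex.exp c * Complex.exp d =
        Complex.exp e * Complex.exp f * Complex.exp g := by
      rw [← Complex.exp_add, ← Complex.exp_add, ← Complex.exp_add, ← Complex.exp_add,
        ← Complex.exp_add, hh]
    linear_combination (s * t) * this
  apply key
  push_cast
  ring

theorem wignerMoyal_phasePoint (ψ : L2 n) (x p : Config n) :
    wignerMoyal ħ ψ ψ (phasePoint x p) = (1 / (2 * Real.pi * ħ : ℂ)) ^ n *
      ∫ y : Config n, Complex.exp (-(Complex.I / ħ) * (inner ℝ p y : ℝ)) *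
        (ψ (x + (1 / 2 : ℝ) • y) * (starRingEnd ℂ) (ψ (x - (1 / 2 : ℝ) • y))) := by
  simp only [wignerMoyal, position_phasePoint, momentum_phasePoint, mul_assoc]

/-- The normalization constant relating Gaussian averages of the Wigner transform to squared
overlaps with Gaussian wave packets. -/
def husimiConst (n : ℕ) (ħ : ℝ) : ℝ :=
  (1 / (2 * Real.pi * ħ)) ^ n * (Real.pi * ħ) ^ ((n : ℝ) / 2)

theorem husimiConst_pos (n : ℕ) (hħ : 0 < ħ) : 0 < husimiConst n ħ := by
  have := Real.pi_pos
  unfold husimiConst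
  positivity

theorem integrable_gaussian_mul_wignerMoyal (hħ : 0 < ħ) (ψ : L2 n) (q x : Config n) :
    Integrable fun p => Complex.exp (-(1 / ħ) * ‖p - q‖ ^ 2) *
      wignerMoyal ħ ψ ψ (phasePoint x p) := by
  have h := (integrable_gaussian_mul_kernel hħ q
    (integrable_wigner_kernel ψ x)).integral_prod_left.const_mul ((1 / (2 * Real.pi * ħ : ℂ)) ^ n)
  refine h.congr (Filter.Eventually.of_forall fun p => ?_)
  simp only [wignerMoyal_phasePoint, integral_const_mul]
  ring

theorem integral_gaussian_mul_wignerMoyal (hħ : 0 < ħ) (ψ : L2 n) (x q a : Config n) :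
    Complex.exp (-(1 / ħ) * ‖a - x‖ ^ 2) * ∫ p, Complex.exp (-(1 / ħ) * ‖p - q‖ ^ 2) *
        wignerMoyal ħ ψ ψ (phasePoint a p) =
      husimiConst n ħ * ∫ y, packetProduct ħ x q ψ (a + (1 / 2 : ℝ) • y) *
        (starRingEnd ℂ) (packetProduct ħ x q ψ (a - (1 / 2 : ℝ) • y)) := by
  simp only [packetProduct_mul_conj, integral_const_mul, wignerMoyal_phasePoint]
  have h := integral_gaussian_mul_kernel hħ q (integrable_wigner_kernel ψ a)
  simp only [mul_left_comm _ ((1 / (2 * Real.pi * ħ : ℂ)) ^ n)]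
  rw [integral_const_mul, h, husimiConst]
  push_cast
  ring

/-- Gaussian averages of the Wigner transform are squared overlaps with Gaussian wave packets. -/
theorem husimi_identity (hħ : 0 < ħ) (ψ : L2 n) (x q : Config n) :
    Integrable (fun a => ∫ p, Real.exp (-(1 / ħ) * ‖a - x‖ ^ 2) *
      (Real.exp (-(1 / ħ) * ‖p - q‖ ^ 2) * wigner ħ ψ (phasePoint a p))) ∧
    ∫ a, ∫ p, Real.exp (-(1 / ħ) * ‖a - x‖ ^ 2) *
      (Real.exp (-(1 / ħ) * ‖p - q‖ ^ 2) * wigner ħ ψ (phasePoint a p)) =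
      husimiConst n ħ * ‖∫ u, packetProduct ħ x q ψ u‖ ^ 2 := by
  have hA := integrable_packetProduct hħ x q ψ
  have hB : Integrable fun u => (starRingEnd ℂ) (packetProduct ħ x q ψ u) := by
    refine hA.norm.mono' (Complex.continuous_conj.comp_aestronglyMeasurable
      hA.aestronglyMeasurable) (Filter.Eventually.of_forall fun u => by simp)
  have hcast : ∀ a, ((∫ p, Real.exp (-(1 / ħ) * ‖a - x‖ ^ 2) *
      (Real.exp (-(1 / ħ) * ‖p - q‖ ^ 2) * wigner ħ ψ (phasePoint a p)) : ℝ) : ℂ) =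
      husimiConst n ħ * ∫ y, packetProduct ħ x q ψ (a + (1 / 2 : ℝ) • y) *
        (starRingEnd ℂ) (packetProduct ħ x q ψ (a - (1 / 2 : ℝ) • y)) := by
    intro a
    rw [← integral_gaussian_mul_wignerMoyal hħ, ← integral_const_mul, ← integral_complex_ofReal]
    refine integral_congr_ae (Filter.Eventually.of_forall fun p => ?_)
    simp only [wignerMoyal_self]
    push_cast
    ring
  have hint := (integrable_integral_half_sum_diff hA hB).const_mul (husimiConst n ħ : ℂ)
  simp only [← hcast] at hint
  refine ⟨by simpa using hint.re, ?_⟩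
  rw [← Complex.ofReal_inj, ← integral_complex_ofReal]
  simp only [hcast]
  rw [integral_const_mul, integral_integral_half_sum_diff hA hB, integral_conj, Complex.mul_conj,
    Complex.normSq_eq_norm_sq]
  push_cast
  rfl

theorem exp_gaussian_mul (a x : Config n) :
    Real.exp (-(1 / ħ) * ‖a - x‖ ^ 2) * Real.exp (-(1 / ħ) * ‖a‖ ^ 2) =
      Real.exp (-(1 / (2 * ħ)) * ‖x‖ ^ 2) *
        Real.exp (-(2 / ħ) * ‖a - (1 / 2 : ℝ) • x‖ ^ 2) := by
  rw [← Real.exp_add, ← Real.exp_add, norm_sub_sq_real, norm_sub_sq_real, norm_smul,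
    inner_smul_right]
  congr 1
  norm_num
  ring

theorem integrable_real_gaussian (hħ : 0 < ħ) (x : Config n) :
    Integrable fun a : Config n => Real.exp (-(2 / ħ) * ‖a - x‖ ^ 2) := by
  have h := (integrable_gaussian (half_pos hħ) x).re
  refine h.congr (Filter.Eventually.of_forall fun a => ?_)
  have : (-(1 / ((ħ / 2 : ℝ) : ℂ)) * (‖a - x‖ : ℂ) ^ 2) =
    ((-(2 / ħ) * ‖a - x‖ ^ 2 : ℝ) : ℂ) := by push_cast; rw [one_div_div]
  simp only [this]
  rw [← Complex.ofReal_exp]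
  exact Complex.ofReal_re _

/-- The averaging weights are positive, so the one-sided bound on `Wψ` can be integrated. Completing
the square in `|a - x|² + |a|²` leaves `|x|²/2`, whence the rate `1/(2ħ)`. -/
theorem norm_integral_packetProduct_le (hħ : 0 < ħ) {ψ : L2 n} {C : ℝ}
    (hψ : ∀ z, wigner ħ ψ z ≤ C * Real.exp (-(1 / ħ) * ‖z‖ ^ 2)) :
    ∃ K : ℝ, ∀ x q : Config n, ‖∫ u, packetProduct ħ x q ψ u‖ ^ 2 ≤
      K * Real.exp (-(1 / (2 * ħ)) * (‖x‖ ^ 2 + ‖q‖ ^ 2)) := by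
  have hpos := husimiConst_pos n hħ
  set K₀ : ℝ := ∫ a : Config n, Real.exp (-(2 / ħ) * ‖a‖ ^ 2) with hK₀
  refine ⟨(husimiConst n ħ)⁻¹ * (C * K₀ ^ 2), fun x q => ?_⟩
  obtain ⟨hint, hval⟩ := husimi_identity hħ ψ x q
  have hg : ∀ x : Config n, Integrable fun a : Config n =>
      Real.exp (-(1 / ħ) * ‖a - x‖ ^ 2) * Real.exp (-(1 / ħ) * ‖a‖ ^ 2) := fun x => by
    simp only [exp_gaussian_mul]
    exact (integrable_real_gaussian hħ _).const_mul _
  have hgi : ∀ x : Config n, ∫ a : Config n,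
      Real.exp (-(1 / ħ) * ‖a - x‖ ^ 2) * Real.exp (-(1 / ħ) * ‖a‖ ^ 2) =
        Real.exp (-(1 / (2 * ħ)) * ‖x‖ ^ 2) * K₀ := fun x => by
    simp only [exp_gaussian_mul]
    rw [integral_const_mul,
      integral_sub_right_eq_self (fun a : Config n => Real.exp (-(2 / ħ) * ‖a‖ ^ 2))]
  have hle : ∀ a, ∫ p, Real.exp (-(1 / ħ) * ‖a - x‖ ^ 2) *
      (Real.exp (-(1 / ħ) * ‖p - q‖ ^ 2) * wigner ħ ψ (phasePoint a p)) ≤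
      (C * (Real.exp (-(1 / (2 * ħ)) * ‖q‖ ^ 2) * K₀)) *
        (Real.exp (-(1 / ħ) * ‖a - x‖ ^ 2) * Real.exp (-(1 / ħ) * ‖a‖ ^ 2)) := by
    intro a
    have hi1 : Integrable fun p => Real.exp (-(1 / ħ) * ‖p - q‖ ^ 2) *
        wigner ħ ψ (phasePoint a p) := by
      have h := (integrable_gaussian_mul_wignerMoyal hħ ψ q a).re
      refine h.congr (Filter.Eventually.of_forall fun p => ?_)
      have : Complex.exp (-(1 / ħ) * ‖p - q‖ ^ 2) * wignerMoyal ħ ψ ψ (phasePoint a p) =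
          ((Real.exp (-(1 / ħ) * ‖p - q‖ ^ 2) * wigner ħ ψ (phasePoint a p) : ℝ) : ℂ) := by
        rw [wignerMoyal_self]; push_cast; rfl
      simp only [this]
      exact Complex.ofReal_re _
    have hmono : ∫ p, Real.exp (-(1 / ħ) * ‖p - q‖ ^ 2) * wigner ħ ψ (phasePoint a p) ≤
        ∫ p, (C * Real.exp (-(1 / ħ) * ‖a‖ ^ 2)) * (Real.exp (-(1 / ħ) * ‖p - q‖ ^ 2) *
          Real.exp (-(1 / ħ) * ‖p‖ ^ 2)) := by
      refine integral_mono hi1 ((hg q).const_mul _) fun p => ?_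
      have h1 := mul_le_mul_of_nonneg_left (hψ (phasePoint a p))
        (Real.exp_pos (-(1 / ħ) * ‖p - q‖ ^ 2)).le
      rw [norm_sq_phasePoint, mul_add, Real.exp_add] at h1
      exact h1.trans_eq (by ring)
    rw [integral_const_mul, hgi] at hmono
    rw [integral_const_mul]
    exact (mul_le_mul_of_nonneg_left hmono (Real.exp_pos _).le).trans_eq (by ring)
  have hmono := integral_mono hint ((hg x).const_mul
    (C * (Real.exp (-(1 / (2 * ħ)) * ‖q‖ ^ 2) * K₀))) hle
  rw [hval, integral_const_mul, hgi] at hmono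
  rw [mul_assoc (husimiConst n ħ)⁻¹, le_inv_mul_iff₀ hpos]
  refine hmono.trans_eq ?_
  rw [mul_add, Real.exp_add]
  ring

/-! ### The Bargmann transform and Liouville's theorem -/

/-- The Bargmann transform of `ψ`, without its Gaussian prefactor, along the complex line
through `q`. -/
def bargmannLine (ħ : ℝ) (ψ : L2 n) (q : Config n) (t : ℂ) : ℂ :=
  ∫ u : Config n, ψ u * Complex.exp (-(1 / (2 * ħ)) * ‖u‖ ^ 2 + t * (inner ℝ q u : ℝ))

theorem integrable_bargmannLine (hħ : 0 < ħ) (ψ : L2 n) (q : Config n) (t : ℂ) :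
    Integrable fun u : Config n =>
      ψ u * Complex.exp (-(1 / (2 * ħ)) * ‖u‖ ^ 2 + t * (inner ℝ q u : ℝ)) := by
  refine (integrable_mul_gaussian hħ ψ (t.re • q)).mono ((Lp.aestronglyMeasurable ψ).mul
    (Continuous.aestronglyMeasurable (by fun_prop))) (Filter.Eventually.of_forall fun u => ?_)
  rw [norm_mul, norm_mul, Complex.norm_exp, Complex.norm_exp]
  simp [inner_smul_left]

theorem differentiable_bargmannLine (hħ : 0 < ħ) (ψ : L2 n) (q : Config n) :
    Differentiable ℂ (bargmannLine ħ ψ q) := by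
  intro t₀
  -- `R` bounds `|Re t|` on the unit ball about `t₀`. The factor `|s|` from differentiation, `s = q
  -- · u`, is absorbed by `|s| ≤ exp |s|`, and `exp((R + 1)|s|)` by the two signed exponentials.
  let R : ℝ := |t₀.re| + 1
  let bound : Config n → ℝ := fun u =>
    ‖ψ u * Complex.exp (-(1 / (2 * ħ)) * ‖u‖ ^ 2 + (inner ℝ ((R + 1) • q) u : ℝ))‖ +
    ‖ψ u * Complex.exp (-(1 / (2 * ħ)) * ‖u‖ ^ 2 + (inner ℝ ((-(R + 1)) • q) u : ℝ))‖
  refine (hasDerivAt_integral_of_dominated_loc_of_deriv_le (s := Metric.ball t₀ 1)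
    (bound := bound) (F' := fun t u => ψ u * (Complex.exp (-(1 / (2 * ħ)) * ‖u‖ ^ 2 +
      t * (inner ℝ q u : ℝ)) * (inner ℝ q u : ℝ)))
    (Metric.ball_mem_nhds t₀ one_pos)
    (Filter.Eventually.of_forall fun t => (integrable_bargmannLine hħ ψ q t).aestronglyMeasurable)
    (integrable_bargmannLine hħ ψ q t₀) ((Lp.aestronglyMeasurable ψ).mul
      (Continuous.aestronglyMeasurable (by fun_prop)))
    (Filter.Eventually.of_forall fun u t ht => ?_)
    ((integrable_mul_gaussian hħ ψ _).norm.add (integrable_mul_gaussian hħ ψ _).norm)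
    (Filter.Eventually.of_forall fun u t _ => ?_)).2.differentiableAt
  · have htR : |t.re| ≤ R := by
      have h1 : |t.re - t₀.re| ≤ 1 := by
        rw [← Complex.sub_re]
        exact (Complex.abs_re_le_norm _).trans (mem_ball_iff_norm.1 ht).le
      have h2 := abs_add_le (t.re - t₀.re) t₀.re
      rw [sub_add_cancel] at h2
      simp only [R]
      linarith
    set s : ℝ := inner ℝ q u with hs
    have hre : ∀ z : ℂ, (-(1 / (2 * ħ : ℂ)) * (‖u‖ : ℂ) ^ 2 + z * (s : ℂ)).re =
        -(1 / (2 * ħ)) * ‖u‖ ^ 2 + z.re * s := by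
      intro z
      have : -(1 / (2 * ħ : ℂ)) * (‖u‖ : ℂ) ^ 2 = ((-(1 / (2 * ħ)) * ‖u‖ ^ 2 : ℝ) : ℂ) := by
        push_cast; rfl
      rw [this, Complex.add_re, Complex.ofReal_re, Complex.re_mul_ofReal]
    have hre' : ∀ r : ℝ, (-(1 / (2 * ħ : ℂ)) * (‖u‖ : ℂ) ^ 2 +
        ((inner ℝ (r • q) u : ℝ) : ℂ)).re = -(1 / (2 * ħ)) * ‖u‖ ^ 2 + r * s := by
      intro r
      have := hre r
      rw [real_inner_smul_left, Complex.ofReal_mul, ← hs]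
      exact this.trans (by rw [Complex.ofReal_re])
    have habs : Real.exp (t.re * s) * |s| ≤ Real.exp ((R + 1) * s) + Real.exp (-(R + 1) * s) := by
      have h3 : Real.exp (t.re * s) * |s| ≤ Real.exp ((R + 1) * |s|) := by
        rw [add_mul, one_mul, Real.exp_add]
        refine mul_le_mul (Real.exp_le_exp.2 ?_) (by linarith [Real.add_one_le_exp |s|])
          (abs_nonneg s) (Real.exp_pos _).le
        exact (le_abs_self _).trans (by
          rw [abs_mul]; exact mul_le_mul_of_nonneg_right htR (abs_nonneg s))
      refine h3.trans ?_
      rcases abs_cases s with ⟨h, -⟩ | ⟨h, -⟩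
      · rw [h]; linarith [Real.exp_pos (-(R + 1) * s)]
      · rw [h, mul_neg, ← neg_mul]; linarith [Real.exp_pos ((R + 1) * s)]
    simp only [bound, norm_mul, Complex.norm_exp, hre, hre', Real.exp_add, Complex.norm_real,
      Real.norm_eq_abs]
    have h4 := mul_le_mul_of_nonneg_left habs
      (mul_nonneg (norm_nonneg (ψ u)) (Real.exp_pos (-(1 / (2 * ħ)) * ‖u‖ ^ 2)).le)
    calc _ = _ := by ring
      _ ≤ _ := h4
      _ = _ := by ring
  · have h1 : HasDerivAt (fun t : ℂ => -(1 / (2 * ħ : ℂ)) * (‖u‖ : ℂ) ^ 2 +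
        t * (inner ℝ q u : ℝ)) ((inner ℝ q u : ℝ) : ℂ) t := by
      simpa using ((hasDerivAt_id t).mul_const ((inner ℝ q u : ℝ) : ℂ)).const_add
        (-(1 / (2 * ħ : ℂ)) * (‖u‖ : ℂ) ^ 2)
    exact h1.cexp.const_mul (ψ u)

/-- The centre is chosen so that `(x - ip)/ħ = tq`: real packet parameters on this plane form one
complex variable. -/
theorem integral_packetProduct_eq (hħ : 0 < ħ) (ψ : L2 n) (q : Config n) (t : ℂ) :
    ∫ u, packetProduct ħ ((ħ * t.re) • q) ((-(ħ * t.im)) • q) ψ u =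
      Complex.exp ((-(ħ / 2) * (t.re ^ 2 * ‖q‖ ^ 2) : ℝ)) * bargmannLine ħ ψ q t := by
  have hħ' : (ħ : ℂ) ≠ 0 := by exact_mod_cast hħ.ne'
  rw [bargmannLine, ← integral_const_mul]
  refine integral_congr_ae (Filter.Eventually.of_forall fun u => ?_)
  simp only [packetProduct]
  rw [mul_left_comm (Complex.exp _) (ψ u), ← Complex.exp_add, ← Complex.exp_add, norm_sub_sq_div]
  congr 2
  rw [inner_smul_left, inner_smul_left, inner_smul_left, norm_smul]
  simp only [RCLike.conj_to_real, Real.norm_eq_abs]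
  have h1 : ((|ħ * t.re| * ‖q‖ : ℝ) : ℂ) ^ 2 = ħ ^ 2 * t.re ^ 2 * ‖q‖ ^ 2 := by
    rw [← Complex.ofReal_pow, mul_pow, sq_abs]; push_cast; ring
  rw [h1]
  push_cast
  field_simp
  linear_combination (2 * ħ * ((inner ℝ q u : ℝ) : ℂ)) * Complex.re_add_im t

/-- A Wigner transform dominated by the standard Gaussian makes the Bargmann transform Gaussian. -/
theorem bargmannLine_eq_of_wigner_le (hħ : 0 < ħ) {ψ : L2 n} {C : ℝ}
    (hψ : ∀ z, wigner ħ ψ z ≤ C * Real.exp (-(1 / ħ) * ‖z‖ ^ 2)) (q : Config n) (t : ℂ) :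
    bargmannLine ħ ψ q t = bargmannLine ħ ψ q 0 * Complex.exp (ħ / 4 * ‖q‖ ^ 2 * t ^ 2) := by
  obtain ⟨K, hK⟩ := norm_integral_packetProduct_le hħ hψ
  -- The overlap bound gives `|B(t)|² ≤ K exp(ħ|q|²((Re t)² - (Im t)²)/2)` for the Bargmann integral
  -- `B`. The growth is that of `|exp(ħ|q|²t²/4)|²`, so this quotient is bounded.
  let G : ℂ → ℂ := fun t => bargmannLine ħ ψ q t * Complex.exp (-(ħ / 4 * ‖q‖ ^ 2 * t ^ 2))
  have hG : Differentiable ℂ G := by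
    have := differentiable_bargmannLine hħ ψ q
    fun_prop
  have hbound : ∀ t, ‖G t‖ ^ 2 ≤ K := by
    intro t
    have h := hK ((ħ * t.re) • q) ((-(ħ * t.im)) • q)
    rw [integral_packetProduct_eq hħ, norm_mul, mul_pow, norm_smul, norm_smul, mul_pow, mul_pow,
      Real.norm_eq_abs, Real.norm_eq_abs, sq_abs, sq_abs, Complex.norm_exp, Complex.ofReal_re,
      ← Real.exp_nat_mul] at h
    have hre : (-((ħ : ℂ) / 4 * ‖q‖ ^ 2 * t ^ 2)).re =
        -(ħ / 4 * ‖q‖ ^ 2 * (t.re ^ 2 - t.im ^ 2)) := by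
      have : (ħ : ℂ) / 4 * ‖q‖ ^ 2 = ((ħ / 4 * ‖q‖ ^ 2 : ℝ) : ℂ) := by push_cast; rfl
      rw [this, Complex.neg_re, Complex.re_ofReal_mul]
      simp [pow_two]
    rw [norm_mul, mul_pow, Complex.norm_exp, hre, ← Real.exp_nat_mul]
    have h2 := mul_le_mul_of_nonneg_right h
      (Real.exp_pos (ħ / 2 * ‖q‖ ^ 2 * (t.re ^ 2 + t.im ^ 2))).le
    have e1 : (1 / (2 * ħ)) * ((ħ * t.re) ^ 2 * ‖q‖ ^ 2 + (-(ħ * t.im)) ^ 2 * ‖q‖ ^ 2) =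
        ħ / 2 * ‖q‖ ^ 2 * (t.re ^ 2 + t.im ^ 2) := by
      field_simp
    rw [neg_mul (1 / (2 * ħ)), e1, mul_assoc K, ← Real.exp_add, neg_add_cancel, Real.exp_zero, mul_one,
      mul_right_comm, ← Real.exp_add] at h2
    rw [mul_comm]
    refine le_of_eq_of_le ?_ h2
    congr 2
    push_cast
    ring
  have hb : Bornology.IsBounded (Set.range G) := by
    refine (Metric.isBounded_closedBall (x := (0 : ℂ)) (r := Real.sqrt K)).subset ?_
    rintro _ ⟨t, rfl⟩
    rw [mem_closedBall_zero_iff]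
    exact Real.le_sqrt_of_sq_le (hbound t)
  have hconst := hG.apply_eq_apply_of_bounded hb t 0
  simp only [G] at hconst
  rw [zero_pow two_ne_zero, mul_zero, neg_zero, Complex.exp_zero, mul_one] at hconst
  rw [← hconst, mul_assoc, ← Complex.exp_add, neg_add_cancel, Complex.exp_zero, mul_one]

theorem bargmannLine_coherentState (hħ : 0 < ħ) (q : Config n) :
    bargmannLine ħ (coherentState n hħ) q (-Complex.I) =
      (((Real.pi * ħ) ^ (-(n : ℝ) / 4) * (Real.pi * ħ) ^ ((n : ℝ) / 2) : ℝ) : ℂ) *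
        Complex.exp (ħ / 4 * ‖q‖ ^ 2 * (-Complex.I) ^ 2) := by
  have hħ' : (ħ : ℂ) ≠ 0 := by exact_mod_cast hħ.ne'
  have h := integral_gaussian_character hħ 0 (ħ • q)
  rw [inner_zero_left, Complex.ofReal_zero, mul_zero, Complex.exp_zero, one_mul] at h
  have h1 : Complex.exp (ħ / 4 * ‖q‖ ^ 2 * (-Complex.I) ^ 2) =
      Complex.exp (-(1 / (4 * ħ)) * ‖ħ • q‖ ^ 2) := by
    rw [norm_smul, Real.norm_of_nonneg hħ.le, neg_sq, Complex.I_sq]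
    congr 1
    push_cast
    field_simp
  rw [Complex.ofReal_mul, mul_assoc, h1, ← h, ← integral_const_mul, bargmannLine]
  refine integral_congr_ae ?_
  filter_upwards [(memLp_gaussianFun n hħ).coeFn_toLp] with u hu
  rw [coherentState, hu, gaussianFun]
  push_cast
  rw [mul_assoc, ← Complex.exp_add, ← Complex.exp_add, sub_zero, inner_smul_right,
    real_inner_comm u q]
  congr 2
  push_cast
  field_simp
  ring

theorem bargmannLine_sub_smul (hħ : 0 < ħ) (ψ φ : L2 n) (c : ℂ) (q : Config n) (t : ℂ) :
    bargmannLine ħ (ψ - c • φ) q t = bargmannLine ħ ψ q t - c * bargmannLine ħ φ q t := by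
  rw [bargmannLine, bargmannLine, bargmannLine, ← integral_const_mul,
    ← integral_sub (integrable_bargmannLine hħ ψ q t)
      ((integrable_bargmannLine hħ φ q t).const_mul c)]
  refine integral_congr_ae ?_
  filter_upwards [Lp.coeFn_sub ψ (c • φ), Lp.coeFn_smul c φ] with u h1 h2
  rw [h1, Pi.sub_apply, h2, Pi.smul_apply, smul_eq_mul]
  ring

/-- At `t = -i` the integral is the Fourier transform at `q` of `χ` times a Gaussian. That product
lies in `L¹ ∩ L²`, and the Gaussian has no zeros. -/
theorem eq_zero_of_bargmannLine_eq_zero (hħ : 0 < ħ) (χ : L2 n)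
    (h : ∀ q, bargmannLine ħ χ q (-Complex.I) = 0) : χ = 0 := by
  have hmem : MemLp (fun u : Config n => χ u * Complex.exp (-(1 / (2 * ħ)) * ‖u‖ ^ 2)) 2
      volume := by
    refine (Lp.memLp χ).of_le_mul (c := 1) ((Lp.aestronglyMeasurable χ).mul
      (Continuous.aestronglyMeasurable (by fun_prop))) (Filter.Eventually.of_forall fun u => ?_)
    have : -(1 / (2 * ħ : ℂ)) * (‖u‖ : ℂ) ^ 2 = ((-(1 / (2 * ħ) * ‖u‖ ^ 2) : ℝ) : ℂ) := by
      push_cast; ring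
    rw [norm_mul, mul_comm, this, Complex.norm_exp, Complex.ofReal_re]
    exact mul_le_mul_of_nonneg_right (Real.exp_le_one_iff.2 (neg_nonpos.2 (by positivity)))
      (norm_nonneg _)
  have hint : Integrable (hmem.toLp) := by
    refine ((integrable_mul_gaussian hħ χ 0).congr ?_).congr hmem.coeFn_toLp.symm
    exact Filter.Eventually.of_forall fun u => by simp
  have hzero := eq_zero_of_fourier_eq_zero hmem.toLp hint fun w => by
    rw [← h w, bargmannLine]
    refine integral_congr_ae ?_
    filter_upwards [hmem.coeFn_toLp] with u hu
    rw [hu, mul_left_comm, ← Complex.exp_add, add_comm]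
  rw [Lp.eq_zero_iff_ae_eq_zero] at hzero ⊢
  filter_upwards [hzero, hmem.coeFn_toLp] with u h1 h2
  rw [h1] at h2
  exact (mul_eq_zero.1 h2.symm).resolve_right (Complex.exp_ne_zero _)

theorem exists_eq_smul_coherentState (hħ : 0 < ħ) {ψ : L2 n} {C : ℝ}
    (hψ : ∀ z, wigner ħ ψ z ≤ C * Real.exp (-(1 / ħ) * ‖z‖ ^ 2)) :
    ∃ c : ℂ, ψ = c • coherentState n hħ := by
  set N : ℂ := (((Real.pi * ħ) ^ (-(n : ℝ) / 4) * (Real.pi * ħ) ^ ((n : ℝ) / 2) : ℝ) : ℂ) with hN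
  have hN0 : N ≠ 0 := by
    have := Real.pi_pos
    rw [hN, Complex.ofReal_ne_zero]
    positivity
  refine ⟨bargmannLine ħ ψ 0 0 / N, sub_eq_zero.1
    (eq_zero_of_bargmannLine_eq_zero hħ _ fun q => ?_)⟩
  rw [bargmannLine_sub_smul hħ, bargmannLine_eq_of_wigner_le hħ hψ, bargmannLine_coherentState,
    ← mul_assoc, div_mul_cancel₀ _ hN0]
  -- At `t = 0` the Bargmann integral does not depend on `q`, so one constant serves every line.
  simp [bargmannLine]

/-! ### The quadratic form of a quantum blob -/

theorem act_smul (M : Matrix (Fin n ⊕ Fin n) (Fin n ⊕ Fin n) ℝ) (r : ℝ) (z : Phase n) :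
    act M (r • z) = r • act M z := map_smul _ _ _

theorem act_injective (S : Matrix.symplecticGroup (Fin n) ℝ) :
    Function.Injective (act (S : Matrix (Fin n ⊕ Fin n) (Fin n ⊕ Fin n) ℝ)) := by
  refine Function.LeftInverse.injective
    (g := act ((S⁻¹ : Matrix.symplecticGroup (Fin n) ℝ) : Matrix _ _ ℝ)) fun z => ?_
  rw [← act_mul, ← Submonoid.coe_mul, inv_mul_cancel, Submonoid.coe_one, act_one]

/-- Both sides are homogeneous of degree two in `z` and have the same sublevel set at height `ħ`.
Scaling gives equal sublevel sets at every positive height, hence equal functions. -/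
theorem inner_act_eq_norm_sq (hħ : 0 < ħ) {M : Matrix (Fin n ⊕ Fin n) (Fin n ⊕ Fin n) ℝ}
    {S : Matrix.symplecticGroup (Fin n) ℝ}
    (hS : ellipsoid ħ M = act (S : Matrix (Fin n ⊕ Fin n) (Fin n ⊕ Fin n) ℝ) ''
      Metric.closedBall 0 (Real.sqrt ħ)) (z : Phase n) :
    inner ℝ (act M (act (S : Matrix (Fin n ⊕ Fin n) (Fin n ⊕ Fin n) ℝ) z))
      (act (S : Matrix (Fin n ⊕ Fin n) (Fin n ⊕ Fin n) ℝ) z) = ‖z‖ ^ 2 := by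
  set Q : Phase n → ℝ := fun z =>
    inner ℝ (act M (act (S : Matrix (Fin n ⊕ Fin n) (Fin n ⊕ Fin n) ℝ) z))
      (act (S : Matrix (Fin n ⊕ Fin n) (Fin n ⊕ Fin n) ℝ) z) with hQ
  have hsmul : ∀ (r : ℝ) z, Q (r • z) = r ^ 2 * Q z := fun r z => by
    simp only [hQ, act_smul, inner_smul_left, inner_smul_right, RCLike.conj_to_real]
    ring
  have hball : ∀ z, Q z ≤ ħ ↔ ‖z‖ ^ 2 ≤ ħ := fun z => by
    have h1 : Q z ≤ ħ ↔ act (S : Matrix (Fin n ⊕ Fin n) (Fin n ⊕ Fin n) ℝ) z ∈ ellipsoid ħ M :=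
      Iff.rfl
    rw [h1, hS, (act_injective S).mem_set_image, mem_closedBall_zero_iff,
      Real.le_sqrt (norm_nonneg z) hħ.le]
  have hlevel : ∀ z (s : ℝ), 0 < s → (Q z ≤ s ↔ ‖z‖ ^ 2 ≤ s) := fun z s hs => by
    have hr : (0 : ℝ) < ħ / s := by positivity
    have h := hball (Real.sqrt (ħ / s) • z)
    have e : ∀ a : ℝ, ħ / s * a ≤ ħ ↔ a ≤ s := fun a => by
      rw [div_mul_eq_mul_div, div_le_iff₀ hs, mul_le_mul_iff_right₀ hħ]
    rwa [hsmul, norm_smul, mul_pow, Real.norm_eq_abs, sq_abs, Real.sq_sqrt hr.le, e, e] at h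
  change Q z = ‖z‖ ^ 2
  rcases eq_or_ne z 0 with rfl | hz
  · have := hsmul 0 0
    rw [zero_smul] at this
    simpa using this
  · have hpos : 0 < ‖z‖ ^ 2 := by positivity
    refine le_antisymm ((hlevel z _ hpos).2 le_rfl) (not_lt.1 fun hlt => ?_)
    -- The maximum keeps the height positive, as `hlevel` requires, and still below `‖z‖ ^ 2`.
    have := (hlevel z (max (Q z) (‖z‖ ^ 2 / 2)) (lt_max_of_lt_right (half_pos hpos))).1
      (le_max_left _ _)
    exact absurd this (not_le.2 (max_lt hlt (half_lt_self hpos)))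

end QuantumBlob

end

theorem mainTheorem2 (n : ℕ) (ħ : ℝ) (hħ : 0 < ħ)
    (M : Matrix (Fin n ⊕ Fin n) (Fin n ⊕ Fin n) ℝ) (hM : M.PosDef)
    (S : Matrix.symplecticGroup (Fin n) ℝ)
    (hS : QuantumBlob.ellipsoid ħ M =
      QuantumBlob.act (S : Matrix (Fin n ⊕ Fin n) (Fin n ⊕ Fin n) ℝ) ''
        Metric.closedBall 0 (Real.sqrt ħ))
    (ψ : QuantumBlob.L2 n) (C : ℝ)
    (hψ : ∀ z : QuantumBlob.Phase n,
      QuantumBlob.wigner ħ ψ z ≤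
        C * Real.exp (-(1 / ħ) * inner ℝ (QuantumBlob.act M z) z)) :
    (∃ Shat : QuantumBlob.metaplecticGroup n ħ, QuantumBlob.Covers ħ Shat S) ∧
    ∀ Shat : QuantumBlob.metaplecticGroup n ħ, QuantumBlob.Covers ħ Shat S →
      ∃ c : ℂ, ψ = c • (Shat : QuantumBlob.L2 n ≃ₗᵢ[ℂ] QuantumBlob.L2 n)
        (QuantumBlob.coherentState n hħ) := by
  refine ⟨QuantumBlob.exists_covers hħ S, fun Shat hcov => ?_⟩
  set U : QuantumBlob.L2 n ≃ₗᵢ[ℂ] QuantumBlob.L2 n := Shat.1 with hU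
  -- Pulling back by `U` gives `W(U⁻¹ψ)(z) = Wψ(Sz)`, so the hypothesis at `Sz` becomes the standard
  -- Gaussian bound at `z`.
  obtain ⟨c, hc⟩ := QuantumBlob.exists_eq_smul_coherentState hħ (ψ := U.symm ψ) (C := C)
    fun z => by
      have h1 := QuantumBlob.wigner_covers hcov (U.symm ψ) z
      rw [← hU, U.apply_symm_apply] at h1
      rw [← h1, ← QuantumBlob.inner_act_eq_norm_sq hħ hS z]
      exact hψ _
  exact ⟨c, by rw [← U.map_smul, ← hc, U.apply_symm_apply]⟩
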